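/- **2-stage stochastic facility location.** There are finite sets $\mathcal F$ of facilities and $\mathcal D$ of clients, metric connection costs $c_{ij}\ge 0$, and finitely many scenarios $A\subseteq\mathcal D$ with probabilities $p_A\ge 0$, $\sum_A p_A=1$. Opening facility $i$ costs $f_i^I\ge 0$ in Stage I and $f_i^A\ge 0$ in Stage II of scenario $A$. Let $(x^*,y^*)$ be an optimal solution of the LP relaxation: minimize $\sum_i f_i^I y_i+\sum_A p_A\big(\sum_i f_i^A y_{A,i}+\sum_{j\in A}\sum_i c_{ij}x_{A,ij}\big)$ subject to $\sum_i x_{A,ij}\ge 1$, $x_{A,ij}\le y_i+y_{A,i}$ and $x,y\ge 0$ (for all $i$, $A$, $j\in A$). Put $F^*=\sum_i f_i^I y^*_i+\sum_A p_A\sum_i f_i^A y^*_{A,i}$ and $C^*=\sum_A p_A\sum_{j\in A}\sum_i c_{ij}x^*_{A,ij}$. **Algorithm.** Put $x^{(1)}_{A,ij}=x^*_{A,ij}\frac{y^*_i}{y^*_i+y^*_{A,i}}$ and $x^{(2)}_{A,ij}=x^*_{A,ij}\frac{y^*_{A,i}}{y^*_i+y^*_{A,i}}$ (both $0$ if $x^*_{A,ij}=0$),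 and let $S$ be the set of pairs $(j,A)$, $j\in A$, with $\sum_i x^{(1)}_{A,ij}\ge \frac12$. Set $\bar y_i=2y^*_i$, $\bar y_{A,i}=2y^*_{A,i}$, $\bar x^{(k)}=2x^{(k)}$. In Stage I, and in Stage II of each scenario, facilities are split into copies of opening in $(0,1]$ such that each pair is served by each copy either not at all or to the full opening of the copy, and such that each $(j,A)\in S$ has a set $F_{(j,A)}$ of Stage I copies serving it of total opening exactly $1$, and each $(j,A)\notin S$ has such a set of copies in Stage II of $A$. Let $R_{(j,A)}=\max_{i\in F_{(j,A)}}c_{ij}$. In Stage I the pairs of $S$, and in Stage II of $A$ the pairs $(j,A)\notin S$, are considered in order of non-decreasing $R_{(j,A)}$; $F_{(j,A)}$ becomes a cluster if it is disjoint from all earlier clusters of the stage. Each cluster opens exactly one copy, chosen with probability equal to its opening; each unclustered copy is opened with probability equal to its opening; all these choices are independent. A facility is open in a stage if one of its copies is. In scenario $A$ every $j\in A$ is connected to the closest facility that is open in Stage I or in Stage II of $A$. Let $(\hat x,\hat y)$ be the resulting integral solution, and let $COST(A)=\sum_i(f_i^I\hat y_i+f_i^A\hat y_{A,i})+\sum_{j\in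 A}\sum_i c_{ij}\hat x_{A,ij}$. **Claim.** Such a splitting and such orders exist. For every such choice, $(\hat x,\hat y)$ is feasible with probability $1$, and: 1. Consider the dual program: maximize $\sum_A p_A\sum_{j\in A}v_{j,A}$ subject to $v_{j,A}-c_{ij}\le w_{ij,A}$, $\sum_A p_A\sum_{j\in A}w_{ij,A}\le f_i^I$, $\sum_{j\in A}w_{ij,A}\le f_i^A$ and $v,w\ge 0$. For every optimal dual solution $(v^*,w^*)$ and every scenario $A$ with $p_A>0$, $$E[COST(A)]\le 3e^{-2}V_A+(1-e^{-2})C_A+2F_A,$$ where $V_A=\sum_{j\in A}v^*_{j,A}$, $C_A=\sum_{j\in A}\sum_i c_{ij}x^*_{A,ij}$ and $F_A=\sum_i(f_i^I y^*_i+f_i^A y^*_{A,i})$. 2. The expected total cost, over the scenario and the random choices of the algorithm, satisfies $$E[COST(\hat x,\hat y)]=\sum_A p_A\,E[COST(A)]\le 2.4061\cdot F^*+1.2707\cdot C^*.$$ -/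

import Mathlib

open scoped BigOperators

noncomputable section

namespace TwoStageFL

/-- A 2-stage stochastic uncapacitated facility location instance with facilities `F`,
clients `D` and explicitly listed scenarios `Scen`. The connection costs form a metric; as only
client-facility distances occur, this is the triangle inequality along paths
`j → i' → j' → i`. -/
structure Inst (F D Scen : Type*) [Fintype F] [Fintype D] [Fintype Scen] where
  /-- the set of clients active in a scenario -/
  clients : Scen → Finset D
  /-- the probability of a scenario -/
  p : Scen → ℝ
  p_nonneg : ∀ A, 0 ≤ p A
  p_sum : ∑ A, p A = 1
  /-- Stage I opening costs -/
  f₁ : F → ℝ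
  f₁_nonneg : ∀ i, 0 ≤ f₁ i
  /-- Stage II opening costs in each scenario -/
  f₂ : Scen → F → ℝ
  f₂_nonneg : ∀ A i, 0 ≤ f₂ A i
  /-- connection costs -/
  c : F → D → ℝ
  c_nonneg : ∀ i j, 0 ≤ c i j
  c_triangle : ∀ i i' j j', c i j ≤ c i' j + c i' j' + c i j'

/-- An assignment of values to the variables of the LP relaxation. The value `x A i j` is
meaningful only for clients `j` of the scenario `A`. -/
structure Sol (F D Scen : Type*) where
  y₁ : F → ℝ
  y₂ : Scen → F → ℝ
  x : Scen → F → D → ℝ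

section LP

variable {F D Scen : Type*} [Fintype F] [Fintype D] [Fintype Scen]

/-- The LP constraints that concern scenario `A`. -/
def ScenFeasible (I : Inst F D Scen) (A : Scen) (y₁ y₂ : F → ℝ) (x : F → D → ℝ) : Prop :=
  (∀ i, 0 ≤ y₁ i) ∧ (∀ i, 0 ≤ y₂ i) ∧
    ∀ j ∈ I.clients A, 1 ≤ ∑ i, x i j ∧ ∀ i, 0 ≤ x i j ∧ x i j ≤ y₁ i + y₂ i

/-- The cost incurred when scenario `A` materializes. -/
def scenCost (I : Inst F D Scen) (A : Scen) (y₁ y₂ : F → ℝ) (x : F → D → ℝ) : ℝ :=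
  ∑ i, (I.f₁ i * y₁ i + I.f₂ A i * y₂ i) + ∑ j ∈ I.clients A, ∑ i, I.c i j * x i j

/-- Feasibility for the LP relaxation. -/
def Feasible (I : Inst F D Scen) (s : Sol F D Scen) : Prop :=
  (∀ i, 0 ≤ s.y₁ i) ∧ ∀ A, ScenFeasible I A s.y₁ (s.y₂ A) (s.x A)

/-- The fractional facility opening cost `F*`. -/
def facCost (I : Inst F D Scen) (s : Sol F D Scen) : ℝ :=
  ∑ i, I.f₁ i * s.y₁ i + ∑ A, I.p A * ∑ i, I.f₂ A i * s.y₂ A i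

/-- The fractional connection cost `C*`. -/
def connCost (I : Inst F D Scen) (s : Sol F D Scen) : ℝ :=
  ∑ A, I.p A * ∑ j ∈ I.clients A, ∑ i, I.c i j * s.x A i j

/-- An optimal solution of the LP relaxation. -/
def Optimal (I : Inst F D Scen) (s : Sol F D Scen) : Prop :=
  Feasible I s ∧ ∀ t, Feasible I t → facCost I s + connCost I s ≤ facCost I t + connCost I t

/-- Feasibility for the dual program. -/
def DualFeasible (I : Inst F D Scen) (v : Scen → D → ℝ) (w : Scen → F → D → ℝ) : Prop :=
  (∀ A, ∀ j ∈ I.clients A, ∀ i, v A j - I.c i j ≤ w A i j) ∧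
  (∀ i, ∑ A, I.p A * ∑ j ∈ I.clients A, w A i j ≤ I.f₁ i) ∧
  (∀ A i, ∑ j ∈ I.clients A, w A i j ≤ I.f₂ A i) ∧
  (∀ A, ∀ j ∈ I.clients A, 0 ≤ v A j ∧ ∀ i, 0 ≤ w A i j)

/-- The objective of the dual program. -/
def dualValue (I : Inst F D Scen) (v : Scen → D → ℝ) : ℝ :=
  ∑ A, I.p A * ∑ j ∈ I.clients A, v A j

/-- An optimal solution of the dual program. -/
def DualOptimal (I : Inst F D Scen) (v : Scen → D → ℝ) (w : Scen → F → D → ℝ) : Prop :=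
  DualFeasible I v w ∧ ∀ v' w', DualFeasible I v' w' → dualValue I v' ≤ dualValue I v

/-- The Stage I part of `x`. It is `0` where `x` is `0`. -/
def Sol.x₁ (s : Sol F D Scen) (A : Scen) (i : F) (j : D) : ℝ :=
  s.x A i j * (s.y₁ i / (s.y₁ i + s.y₂ A i))

/-- The Stage II part of `x`. It is `0` where `x` is `0`. -/
def Sol.x₂ (s : Sol F D Scen) (A : Scen) (i : F) (j : D) : ℝ :=
  s.x A i j * (s.y₂ A i / (s.y₁ i + s.y₂ A i))

/-- The client-scenario pair `(j, A)` is first stage clustered: `j` is served in Stage I to an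
extent of at least `1/2`. -/
def FirstStage (s : Sol F D Scen) (A : Scen) (j : D) : Prop :=
  1 / 2 ≤ ∑ i, s.x₁ A i j

end LP

section Rounding

open Classical in
/-- Greedy clustering: go through the list, and turn the candidate set of an element into a new
cluster if it contains nothing from the clusters formed before. -/
def greedyClusters {P G : Type*} (cand : P → Finset G) (order : List P) : Finset (Finset G) :=
  order.foldl (fun 𝒞 q => if ∀ K ∈ 𝒞, Disjoint K (cand q) then insert (cand q) 𝒞 else 𝒞) ∅

open Classical in
/-- The probability that exactly the elements of `O` are opened, when each cluster opens exactly
one of its elements, `g` with probability `z g`, each unclustered `g` is opened with probability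
`z g`, and all these choices are independent. -/
def openProb {G : Type*} [Fintype G] (z : G → ℝ) (𝒞 : Finset (Finset G)) (O : Finset G) : ℝ :=
  (∏ K ∈ 𝒞, if (O ∩ K).card = 1 then ∑ g ∈ O ∩ K, z g else 0) *
    ∏ g with ∀ K ∈ 𝒞, g ∉ K, if g ∈ O then z g else 1 - z g

open Classical in
/-- A splitting of the facilities of one stage (Stage I, or Stage II of one scenario) into copies,
with cluster candidates. `Y` are the scaled opening values of that stage, `X q` the scaled
values by which the client of `q` is served in it, and `Sel q` says that `q` is to be clustered in
this stage. Every copy is opened to a positive extent of at most one, and serves each `q` either not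
at all or to its full extent. -/
structure Splitting {F P : Type*} (Y : F → ℝ) (X : P → F → ℝ) (Sel : P → Prop) where
  /-- the number of copies -/
  n : ℕ
  /-- the facility that a copy belongs to -/
  fac : Fin n → F
  /-- the fractional opening of a copy -/
  z : Fin n → ℝ
  z_pos : ∀ g, 0 < z g
  z_le_one : ∀ g, z g ≤ 1
  /-- the copies that serve `q` -/
  serv : P → Finset (Fin n)
  sum_z : ∀ i, ∑ g with fac g = i, z g = Y i
  sum_serv : ∀ q i, ∑ g ∈ serv q with fac g = i, z g = X q i
  /-- the cluster candidate of `q` -/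
  cand : P → Finset (Fin n)
  cand_subset : ∀ q, Sel q → cand q ⊆ serv q
  sum_cand : ∀ q, Sel q → ∑ g ∈ cand q, z g = 1

/-- The maximal distance `R` from the client of `q` to a member of its cluster candidate; `d q i` is
the distance from the client of `q` to the facility `i`. -/
def Splitting.radius {F P : Type*} {Y : F → ℝ} {X : P → F → ℝ} {Sel : P → Prop}
    (S : Splitting Y X Sel) (d : P → F → ℝ) (q : P) : ℝ :=
  if h : (S.cand q).Nonempty then (S.cand q).sup' h (fun g => d q (S.fac g)) else 0

/-- The choices that the algorithm is free to make in one stage: the splitting, and the order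
(non-decreasing in `R`) in which the elements that are to be clustered in this stage are
considered. -/
structure StageRun {F P : Type*} (Y : F → ℝ) (X : P → F → ℝ) (Sel : P → Prop)
    (d : P → F → ℝ) extends Splitting Y X Sel where
  order : List P
  order_nodup : order.Nodup
  mem_order : ∀ q, q ∈ order ↔ Sel q
  order_sorted : order.Pairwise (fun q q' => toSplitting.radius d q ≤ toSplitting.radius d q')

variable {F P : Type*} {Y : F → ℝ} {X : P → F → ℝ} {Sel : P → Prop} {d : P → F → ℝ}

/-- The clusters of a stage. -/
def StageRun.clusters (S : StageRun Y X Sel d) : Finset (Finset (Fin S.n)) :=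
  greedyClusters S.cand S.order

/-- The probability that `O` is the set of copies opened in a stage. -/
def StageRun.prob (S : StageRun Y X Sel d) (O : Finset (Fin S.n)) : ℝ :=
  openProb S.z S.clusters O

open Classical in
/-- The facilities that have a copy in `O`. -/
def StageRun.facs (S : StageRun Y X Sel d) (O : Finset (Fin S.n)) : Finset F :=
  O.image S.fac

end Rounding

section Algorithm

variable {F D Scen : Type*} [Fintype F] [Fintype D] [Fintype Scen]

/-- A run of the algorithm on the fractional solution `s`, up to its random choices. Stage I and
the Stages II of the scenarios have separate copies of each facility. All values are scaled
by `2`; the first stage clustered pairs are clustered in Stage I, the other ones in Stage II of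
their scenario. -/
structure Run (I : Inst F D Scen) (s : Sol F D Scen) where
  first : StageRun (P := {q : Scen × D // q.2 ∈ I.clients q.1})
    (fun i => 2 * s.y₁ i) (fun q i => 2 * s.x₁ q.1.1 i q.1.2)
    (fun q => FirstStage s q.1.1 q.1.2) (fun q i => I.c i q.1.2)
  second : ∀ A, StageRun (P := {j : D // j ∈ I.clients A})
    (fun i => 2 * s.y₂ A i) (fun j i => 2 * s.x₂ A i j.1)
    (fun j => ¬ FirstStage s A j.1) (fun j i => I.c i j.1)

open Classical in
/-- The integral opening vector of the set `O`. -/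
def yhat (O : Finset F) (i : F) : ℝ := if i ∈ O then 1 else 0

/-- A facility of `O` that is closest to the client `j`. -/
def nearest (I : Inst F D Scen) (O : Finset F) (h : O.Nonempty) (j : D) : F :=
  (O.exists_min_image (fun i => I.c i j) h).choose

open Classical in
/-- The integral assignment that connects each client to the closest facility of `O` (and to
nothing if `O` is empty). -/
def xhat (I : Inst F D Scen) (O : Finset F) (i : F) (j : D) : ℝ :=
  if h : O.Nonempty then (if i = nearest I O h j then 1 else 0) else 0

variable {I : Inst F D Scen} {s : Sol F D Scen}

open Classical in
/-- The facilities open in scenario `A` when the copies in `O₁` are opened in Stage I and the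
copies in `O₂` in Stage II. -/
def Run.opened (r : Run I s) (A : Scen) (O₁ : Finset (Fin r.first.n))
    (O₂ : Finset (Fin (r.second A).n)) : Finset F :=
  r.first.facs O₁ ∪ (r.second A).facs O₂

/-- The cost of the integral solution in scenario `A`, as a function of the random choices. -/
def Run.cost (r : Run I s) (A : Scen) (O₁ : Finset (Fin r.first.n))
    (O₂ : Finset (Fin (r.second A).n)) : ℝ :=
  scenCost I A (yhat (r.first.facs O₁)) (yhat ((r.second A).facs O₂))
    (xhat I (r.opened A O₁ O₂))

/-- The integral solution serves all clients of scenario `A` from open facilities. -/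
def Run.OutcomeFeasible (r : Run I s) (A : Scen) (O₁ : Finset (Fin r.first.n))
    (O₂ : Finset (Fin (r.second A).n)) : Prop :=
  ScenFeasible I A (yhat (r.first.facs O₁)) (yhat ((r.second A).facs O₂))
    (xhat I (r.opened A O₁ O₂))

/-- The expectation of the cost in scenario `A` over the (independent) random choices made in Stage
I and in Stage II of `A`. -/
def Run.expScenCost (r : Run I s) (A : Scen) : ℝ :=
  ∑ O₁, ∑ O₂, r.first.prob O₁ * (r.second A).prob O₂ * r.cost A O₁ O₂

/-- The expectation of the cost over the choice of the scenario and the random choices of the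
algorithm. -/
def Run.expCost (r : Run I s) : ℝ := ∑ A, I.p A * r.expScenCost A

end Algorithm

section Law

/-- The set of opened copies has a probability distribution on the subsets. -/
theorem openProb_sum {G : Type*} [Fintype G] (z : G → ℝ) (𝒞 : Finset (Finset G))
    (hd : ∀ K ∈ 𝒞, ∀ K' ∈ 𝒞, K ≠ K' → Disjoint K K') (hz : ∀ K ∈ 𝒞, ∑ g ∈ K, z g = 1) :
    ∑ O, openProb z 𝒞 O = 1 := by
  classical
  have key : ∀ 𝒦 : Finset (Finset G), 𝒦 ⊆ 𝒞 →
      ∑ O ∈ ((Finset.univ.filter fun g => ∀ K ∈ 𝒞, g ∉ K) ∪ 𝒦.biUnion id).powerset,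
        (∏ K ∈ 𝒦, if (O ∩ K).card = 1 then ∑ g ∈ O ∩ K, z g else 0) *
          ∏ g with ∀ K ∈ 𝒞, g ∉ K, (if g ∈ O then z g else 1 - z g) = 1 := by
    intro 𝒦
    induction 𝒦 using Finset.induction_on with
    | empty =>
      intro _
      have h := Finset.prod_add (fun g => z g) (fun g => 1 - z g)
        (Finset.univ.filter fun g => ∀ K ∈ 𝒞, g ∉ K)
      simp only [add_sub_cancel, Finset.prod_const_one] at h
      simp only [Finset.biUnion_empty, Finset.union_empty, Finset.prod_empty, one_mul]
      refine Eq.trans ?_ h.symm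
      refine Finset.sum_congr rfl fun O hO => ?_
      rw [Finset.prod_ite]
      congr 1
      · refine Finset.prod_congr ?_ fun _ _ => rfl
        ext g
        have := @Finset.mem_powerset.1 hO g
        simp only [Finset.mem_filter, Finset.mem_univ, true_and] at this ⊢
        tauto
      · refine Finset.prod_congr ?_ fun _ _ => rfl
        ext g
        simp only [Finset.mem_filter, Finset.mem_sdiff]
    | insert K 𝒦 hK ih =>
      intro hsub
      have hK' : K ∈ 𝒞 := hsub (Finset.mem_insert_self _ _)
      have h𝒦 : 𝒦 ⊆ 𝒞 := fun L hL => hsub (Finset.mem_insert_of_mem hL)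
      have ih := ih h𝒦
      set U := Finset.univ.filter fun g => ∀ K ∈ 𝒞, g ∉ K with hU
      have hdis : Disjoint K (U ∪ 𝒦.biUnion id) := by
        rw [Finset.disjoint_union_right, Finset.disjoint_biUnion_right]
        refine ⟨?_, fun L hL => hd K hK' L (h𝒦 hL) fun h => hK (h ▸ hL)⟩
        rw [Finset.disjoint_left]
        intro g hg hgU
        exact (Finset.mem_filter.1 hgU).2 K hK' hg
      have e : U ∪ (insert K 𝒦).biUnion id = K ∪ (U ∪ 𝒦.biUnion id) := by
        rw [Finset.biUnion_insert]; simp only [id]; ac_rfl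
      have hone : ∑ Q ∈ K.powerset, (if Q.card = 1 then ∑ g ∈ Q, z g else 0) = 1 := by
        rw [← Finset.sum_filter, ← Finset.powersetCard_eq_filter, Finset.powersetCard_one,
          Finset.sum_map]
        simpa using hz K hK'
      rw [e]
      trans ∑ q ∈ K.powerset ×ˢ (U ∪ 𝒦.biUnion id).powerset,
        (if q.1.card = 1 then ∑ g ∈ q.1, z g else 0) *
        ((∏ K ∈ 𝒦, if (q.2 ∩ K).card = 1 then ∑ g ∈ q.2 ∩ K, z g else 0) *
          ∏ g ∈ U, (if g ∈ q.2 then z g else 1 - z g))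
      · symm
        refine Finset.sum_bij' (fun q _ => q.1 ∪ q.2)
          (fun O _ => (O ∩ K, O ∩ (U ∪ 𝒦.biUnion id))) ?_ ?_ ?_ ?_ ?_
        · rintro ⟨Q, O⟩ h
          rw [Finset.mem_product, Finset.mem_powerset, Finset.mem_powerset] at h
          exact Finset.mem_powerset.2 (Finset.union_subset_union h.1 h.2)
        · intro O _
          exact Finset.mem_product.2 ⟨Finset.mem_powerset.2 Finset.inter_subset_right,
            Finset.mem_powerset.2 Finset.inter_subset_right⟩
        · rintro ⟨Q, O⟩ h
          rw [Finset.mem_product, Finset.mem_powerset, Finset.mem_powerset] at h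
          have h1 := Finset.disjoint_of_subset_left h.1 hdis
          have h2 := Finset.disjoint_of_subset_right h.2 hdis
          simp only [Prod.mk.injEq]
          rw [Finset.union_inter_distrib_right, Finset.union_inter_distrib_right,
            Finset.inter_eq_left.2 h.1, Finset.inter_eq_left.2 h.2,
            Finset.disjoint_iff_inter_eq_empty.1 h1, Finset.disjoint_iff_inter_eq_empty.1 h2.symm]
          simp
        · intro O h
          simp only
          rw [← Finset.inter_union_distrib_left, Finset.inter_eq_left]
          exact Finset.mem_powerset.1 h
        · rintro ⟨Q, O⟩ h
          rw [Finset.mem_product, Finset.mem_powerset, Finset.mem_powerset] at h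
          have h2 := Finset.disjoint_of_subset_right h.2 hdis
          simp only
          rw [Finset.prod_insert hK, mul_assoc]
          have eK : (Q ∪ O) ∩ K = Q := by
            rw [Finset.union_inter_distrib_right, Finset.inter_eq_left.2 h.1,
              Finset.disjoint_iff_inter_eq_empty.1 h2.symm, Finset.union_empty]
          rw [eK]
          congr 2
          · refine Finset.prod_congr rfl fun L hL => ?_
            have : (Q ∪ O) ∩ L = O ∩ L := by
              have h3 : Disjoint Q L := Finset.disjoint_of_subset_left h.1
                (hd K hK' L (h𝒦 hL) fun h => hK (h ▸ hL))
              rw [Finset.union_inter_distrib_right, Finset.disjoint_iff_inter_eq_empty.1 h3,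
                Finset.empty_union]
            rw [this]
          · refine Finset.prod_congr rfl fun g hg => ?_
            have : g ∉ Q := fun hq => (Finset.mem_filter.1 hg).2 K hK' (h.1 hq)
            simp [this]
      · rw [Finset.sum_product]
        simp only
        simp_rw [← Finset.mul_sum, ih, mul_one]
        exact hone
  have h := key 𝒞 (Finset.Subset.refl _)
  have hu : (Finset.univ.filter fun g => ∀ K ∈ 𝒞, g ∉ K) ∪ 𝒞.biUnion id = Finset.univ := by
    ext g
    simp only [Finset.mem_union, Finset.mem_filter, Finset.mem_univ, true_and, Finset.mem_biUnion,
      id, iff_true]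
    by_cases hg : ∃ K ∈ 𝒞, g ∈ K
    · exact Or.inr hg
    · push Not at hg
      exact Or.inl hg
  rw [hu, Finset.powerset_univ] at h
  exact h

/-- The clusters of a stage are disjoint cluster candidates. -/
theorem greedyClusters_spec {P G : Type*} (cand : P → Finset G) (order : List P) :
    (∀ K ∈ greedyClusters cand order, ∃ q ∈ order, K = cand q) ∧
    (∀ K ∈ greedyClusters cand order, ∀ K' ∈ greedyClusters cand order, K ≠ K' → Disjoint K K') := by
  classical
  induction order using List.reverseRecOn with
  | nil => simp [greedyClusters]
  | append_singleton l q ih =>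
    obtain ⟨h1, h2⟩ := ih
    have e : greedyClusters cand (l ++ [q]) =
        if ∀ K ∈ greedyClusters cand l, Disjoint K (cand q) then
          insert (cand q) (greedyClusters cand l) else greedyClusters cand l := by
      simp only [greedyClusters, List.foldl_append, List.foldl_cons, List.foldl_nil]
      congr
    rw [e]
    split_ifs with h
    · refine ⟨fun K hK => ?_, fun K hK K' hK' hne => ?_⟩
      · rcases Finset.mem_insert.1 hK with rfl | hK
        · exact ⟨q, by simp, rfl⟩
        · obtain ⟨q', hq, rfl⟩ := h1 K hK
          exact ⟨q', by simp [hq], rfl⟩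
      · rcases Finset.mem_insert.1 hK with rfl | hK <;> rcases Finset.mem_insert.1 hK' with rfl | hK'
        · exact absurd rfl hne
        · exact (h K' hK').symm
        · exact h K hK
        · exact h2 K hK K' hK' hne
    · refine ⟨fun K hK => ?_, h2⟩
      obtain ⟨q', hq, rfl⟩ := h1 K hK
      exact ⟨q', by simp [hq], rfl⟩

/-- The total probability of the outcomes of a stage is one. -/
theorem StageRun.prob_sum {F P : Type*} {Y : F → ℝ} {X : P → F → ℝ} {Sel : P → Prop}
    {d : P → F → ℝ} (S : StageRun Y X Sel d) : ∑ O, S.prob O = 1 := by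
  obtain ⟨h1, h2⟩ := greedyClusters_spec S.cand S.order
  refine openProb_sum S.z S.clusters h2 fun K hK => ?_
  obtain ⟨q, hq, rfl⟩ := h1 K hK
  exact S.sum_cand q ((S.mem_order q).1 hq)

end Law

end TwoStageFL

end

/-! Opening cost: a copy is opened with probability exactly its opening `z`, clustered or not, so a
union bound over copies opens each facility with probability at most twice its fractional value.
This gives the term `2 * F_A`.

Connection cost: fix a client with dual value `V`. By complementary slackness
(`complementary_slackness`) every facility serving it fractionally lies within `V`, hence so does
its radius `R`. Its candidate set meets a cluster whose owner has no larger radius, and that cluster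
opens a copy, so three edges of the triangle inequality give an open facility within `3 * R ≤ 3 * V`
with certainty (`StageRun.exists_open_near`). The copies serving the client in both stages have
total opening 2. Any set of copies of total opening `u` is missed with probability at most `exp
(-u)`, by `1 - t ≤ exp (-t)` and independence. Concavity turns this into a hitting probability of at
least `(1 - exp (-2)) / 2 * u` for `u ≤ 2` (`hit_prob_ge`). Applying this to all sublevel sets of
the distance, and integrating over the levels (`sum_le_of_hit`), shows that the saving against `3 *
V` is in expectation at least `1 - exp (-2)` times its fractional average. This is the bound `3 *
exp (-2) * V + (1 - exp (-2)) * C` of `expected_dist_le`.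

Averaging over scenarios, strong duality replaces the sum of the `V` by `F* + C*`. The coefficients
become `2 + 3 * exp (-2)` and `1 + 2 * exp (-2)`. Strong duality itself comes from Farkas' lemma on
the homogenized LP. -/

noncomputable section

namespace TwoStageFL

/-! ### LP duality and complementary slackness -/

section Duality

/-- **Farkas' lemma** for finitely many linear functionals. -/
theorem farkas {V ι : Type*} [AddCommGroup V] [Module ℝ V] (S : Finset ι) :
    ∀ (a : ι → V →ₗ[ℝ] ℝ) (b : V →ₗ[ℝ] ℝ), (∀ x, (∀ i ∈ S, 0 ≤ a i x) → 0 ≤ b x) →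
      ∃ l : ι → ℝ, (∀ i, 0 ≤ l i) ∧ ∀ x, b x = ∑ i ∈ S, l i * a i x := by
  classical
  induction S using Finset.induction_on with
  | empty =>
    intro a b h
    refine ⟨fun _ => 0, fun _ => le_rfl, fun x => ?_⟩
    have h1 := h x (by simp)
    have h2 := h (-x) (by simp)
    rw [map_neg] at h2
    rw [Finset.sum_empty]
    linarith
  | insert k S hk ih =>
    intro a b h
    by_cases hb : ∀ x, (∀ i ∈ S, 0 ≤ a i x) → 0 ≤ b x
    · obtain ⟨l, hl, hsum⟩ := ih a b hb
      refine ⟨Function.update l k 0, fun i => ?_, fun x => ?_⟩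
      · by_cases hi : i = k
        · simp [hi]
        · simpa [hi] using hl i
      · rw [Finset.sum_insert hk, hsum]
        simp only [Function.update_self, zero_mul, zero_add]
        refine Finset.sum_congr rfl fun i hi => ?_
        rw [Function.update_of_ne (ne_of_mem_of_not_mem hi hk)]
    -- Constraint `k` is now indispensable. Some `x` violates it alone, and it is scaled to `u` with
    -- `a k u = -1`.
    · push Not at hb
      obtain ⟨x, hx, hbx⟩ := hb
      have hkx : a k x < 0 := by
        by_contra hkx
        push Not at hkx
        exact absurd (h x (Finset.forall_mem_insert _ _ _ |>.2 ⟨hkx, hx⟩)) (not_le.2 hbx)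
      set t : ℝ := (-a k x)⁻¹ with ht
      have ht0 : 0 < t := inv_pos.2 (by linarith)
      set u : V := t • x with hu
      have hku : a k u = -1 := by
        rw [hu, map_smul, smul_eq_mul, ht]
        field_simp [hkx.ne]
      have hau : ∀ i ∈ S, 0 ≤ a i u := fun i hi => by
        rw [hu, map_smul, smul_eq_mul]
        exact mul_nonneg ht0.le (hx i hi)
      have hbu : b u ≤ 0 := by
        rw [hu, map_smul, smul_eq_mul]
        exact mul_nonpos_of_nonneg_of_nonpos ht0.le hbx.le
      -- These are the functionals composed with `y ↦ y + (a k y) • u`, the projection along `u`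
      -- onto the kernel of `a k`. There constraint `k` holds with equality, so the induction
      -- hypothesis applies.
      obtain ⟨l, hl, hsum⟩ := ih (fun i => a i + (a i u) • a k) (b + (b u) • a k) (by
        intro y hy
        have := h (y + (a k y) • u) (by
          intro i hi
          rcases Finset.mem_insert.1 hi with rfl | hi
          · simp [hku]
          · have := hy i hi
            simp only [LinearMap.add_apply, LinearMap.smul_apply, smul_eq_mul] at this
            simp only [map_add, map_smul, smul_eq_mul]
            linarith)
        simp only [map_add, map_smul, smul_eq_mul] at this
        simp only [LinearMap.add_apply, LinearMap.smul_apply, smul_eq_mul]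
        linarith)
      refine ⟨Function.update l k (∑ i ∈ S, l i * a i u - b u), fun i => ?_, fun y => ?_⟩
      · by_cases hi : i = k
        · subst hi
          rw [Function.update_self]
          have := Finset.sum_nonneg fun j hj => mul_nonneg (hl j) (hau j hj)
          linarith
        · simpa [hi] using hl i
      · have e := hsum y
        simp only [LinearMap.add_apply, LinearMap.smul_apply, smul_eq_mul, mul_add,
          Finset.sum_add_distrib] at e
        rw [Finset.sum_insert hk, Function.update_self, sub_mul, Finset.sum_mul]
        have e1 : ∑ i ∈ S, Function.update l k (∑ i ∈ S, l i * a i u - b u) i * a i y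
            = ∑ i ∈ S, l i * a i y := Finset.sum_congr rfl fun i hi => by
          rw [Function.update_of_ne (ne_of_mem_of_not_mem hi hk)]
        rw [e1]
        simp only [mul_assoc] at e ⊢
        linarith

variable {F D Scen : Type*} [Fintype F] [Fintype D] [Fintype Scen]

/-- Assignments to the LP variables together with a homogenizing variable. -/
abbrev HomSol (F D Scen : Type*) :=
  (F → ℝ) × (Scen → F → ℝ) × (Scen → F → D → ℝ) × ℝ

/-- The Stage I opening variable of a facility. -/
def HomSol.y₁ (i : F) : HomSol F D Scen →ₗ[ℝ] ℝ := LinearMap.proj i ∘ₗ LinearMap.fst ℝ _ _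

/-- The Stage II opening variable of a facility. -/
def HomSol.y₂ (A : Scen) (i : F) : HomSol F D Scen →ₗ[ℝ] ℝ :=
  LinearMap.proj i ∘ₗ LinearMap.proj A ∘ₗ LinearMap.fst ℝ _ _ ∘ₗ LinearMap.snd ℝ _ _

/-- The assignment variable of a client and a facility. -/
def HomSol.x (A : Scen) (i : F) (j : D) : HomSol F D Scen →ₗ[ℝ] ℝ :=
  LinearMap.proj j ∘ₗ LinearMap.proj i ∘ₗ LinearMap.proj A ∘ₗ LinearMap.fst ℝ _ _ ∘ₗ
    LinearMap.snd ℝ _ _ ∘ₗ LinearMap.snd ℝ _ _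

/-- The homogenizing variable. -/
def HomSol.t : HomSol F D Scen →ₗ[ℝ] ℝ :=
  LinearMap.snd ℝ _ _ ∘ₗ LinearMap.snd ℝ _ _ ∘ₗ LinearMap.snd ℝ _ _

open HomSol in
open Classical in
/-- The homogenized LP constraints. -/
def homConstraint (I : Inst F D Scen) :
    F ⊕ (Scen × F) ⊕ (Scen × F × D) ⊕ Unit ⊕ (Scen × D) ⊕ (Scen × F × D) →
      HomSol F D Scen →ₗ[ℝ] ℝ
  | .inl i => y₁ i
  | .inr (.inl (A, i)) => y₂ A i
  | .inr (.inr (.inl (A, i, j))) => x A i j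
  | .inr (.inr (.inr (.inl _))) => t
  | .inr (.inr (.inr (.inr (.inl (A, j))))) =>
      if j ∈ I.clients A then ∑ i, x A i j - t else 0
  | .inr (.inr (.inr (.inr (.inr (A, i, j))))) =>
      if j ∈ I.clients A then y₁ i + y₂ A i - x A i j else 0

open HomSol in
/-- The LP objective minus a constant. -/
def homObjective (I : Inst F D Scen) (r : ℝ) : HomSol F D Scen →ₗ[ℝ] ℝ :=
  ∑ i, I.f₁ i • y₁ i + ∑ A, I.p A • ∑ i, I.f₂ A i • y₂ A i
    + ∑ A, I.p A • ∑ j ∈ I.clients A, ∑ i, I.c i j • x A i j - r • t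

theorem homObjective_apply (I : Inst F D Scen) (r : ℝ) (z : HomSol F D Scen) :
    homObjective I r z = facCost I ⟨z.1, z.2.1, z.2.2.1⟩ + connCost I ⟨z.1, z.2.1, z.2.2.1⟩
      - r * z.2.2.2 := by
  simp [homObjective, HomSol.y₁, HomSol.y₂, HomSol.x, HomSol.t, facCost, connCost,
    LinearMap.sum_apply]

/-- For `t > 0`, dividing by `t` gives a feasible LP solution, whose cost optimality bounds from
below. For `t = 0` the claim is just nonnegativity of the costs. This is the hypothesis that Farkas'
lemma needs. -/
theorem homObjective_nonneg (I : Inst F D Scen) (s : Sol F D Scen) (hs : Optimal I s)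
    (z : HomSol F D Scen) (hz : ∀ k, 0 ≤ homConstraint I k z) :
    0 ≤ homObjective I (facCost I s + connCost I s) z := by
  rw [homObjective_apply]
  obtain ⟨z₁, z₂, z₃, t⟩ := z
  have h1 : ∀ i, 0 ≤ z₁ i := fun i => hz (.inl i)
  have h2 : ∀ A i, 0 ≤ z₂ A i := fun A i => hz (.inr (.inl (A, i)))
  have h3 : ∀ A i j, 0 ≤ z₃ A i j := fun A i j => hz (.inr (.inr (.inl (A, i, j))))
  have h4 : 0 ≤ t := hz (.inr (.inr (.inr (.inl ()))))
  have h5 : ∀ A, ∀ j ∈ I.clients A, t ≤ ∑ i, z₃ A i j := fun A j hj => by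
    simpa [homConstraint, hj, HomSol.t, HomSol.x, LinearMap.sum_apply] using
      hz (.inr (.inr (.inr (.inr (.inl (A, j))))))
  have h6 : ∀ A, ∀ j ∈ I.clients A, ∀ i, z₃ A i j ≤ z₁ i + z₂ A i := fun A j hj i => by
    simpa [homConstraint, hj, HomSol.y₁, HomSol.y₂, HomSol.x] using
      hz (.inr (.inr (.inr (.inr (.inr (A, i, j))))))
  simp only
  rcases h4.eq_or_lt with rfl | ht
  · rw [mul_zero, sub_zero]
    refine add_nonneg (add_nonneg ?_ ?_) ?_
    · exact Finset.sum_nonneg fun i _ => mul_nonneg (I.f₁_nonneg i) (h1 i)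
    · exact Finset.sum_nonneg fun A _ => mul_nonneg (I.p_nonneg A) <|
        Finset.sum_nonneg fun i _ => mul_nonneg (I.f₂_nonneg A i) (h2 A i)
    · exact Finset.sum_nonneg fun A _ => mul_nonneg (I.p_nonneg A) <|
        Finset.sum_nonneg fun j _ => Finset.sum_nonneg fun i _ =>
          mul_nonneg (I.c_nonneg i j) (h3 A i j)
  · have hit : 0 ≤ t⁻¹ := (inv_pos.2 ht).le
    have hfe : Feasible I ⟨fun i => t⁻¹ * z₁ i, fun A i => t⁻¹ * z₂ A i,
        fun A i j => t⁻¹ * z₃ A i j⟩ := by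
      refine ⟨fun i => mul_nonneg hit (h1 i), fun A => ⟨fun i => mul_nonneg hit (h1 i),
        fun i => mul_nonneg hit (h2 A i), fun j hj => ⟨?_, fun i =>
          ⟨mul_nonneg hit (h3 A i j), ?_⟩⟩⟩⟩
      · simp only
        rw [← Finset.mul_sum, ← inv_mul_cancel₀ ht.ne']
        exact mul_le_mul_of_nonneg_left (h5 A j hj) hit
      · simp only
        rw [← mul_add]
        exact mul_le_mul_of_nonneg_left (h6 A j hj i) hit
    have h := hs.2 _ hfe
    have e : facCost I ⟨fun i => t⁻¹ * z₁ i, fun A i => t⁻¹ * z₂ A i,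
        fun A i j => t⁻¹ * z₃ A i j⟩ + connCost I ⟨fun i => t⁻¹ * z₁ i, fun A i => t⁻¹ * z₂ A i,
        fun A i j => t⁻¹ * z₃ A i j⟩ = t⁻¹ * (facCost I ⟨z₁, z₂, z₃⟩ + connCost I ⟨z₁, z₂, z₃⟩) := by
      simp only [facCost, connCost, mul_left_comm _ t⁻¹, ← Finset.mul_sum, mul_add]
    rw [e] at h
    have h' := mul_le_mul_of_nonneg_left h ht.le
    rw [mul_inv_cancel_left₀ ht.ne'] at h'
    linarith

open Classical in
/-- The LP multipliers obtained from Farkas' lemma. -/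
theorem exists_multipliers (I : Inst F D Scen) (s : Sol F D Scen) (hs : Optimal I s) :
    ∃ (α : Scen → D → ℝ) (β : Scen → F → D → ℝ),
      (∀ A j, 0 ≤ α A j) ∧ (∀ A i j, 0 ≤ β A i j) ∧
      (∀ A, ∀ j ∈ I.clients A, ∀ i, α A j - β A i j ≤ I.p A * I.c i j) ∧
      (∀ i, ∑ A, ∑ j ∈ I.clients A, β A i j ≤ I.f₁ i) ∧
      (∀ A i, ∑ j ∈ I.clients A, β A i j ≤ I.p A * I.f₂ A i) ∧
      facCost I s + connCost I s ≤ ∑ A, ∑ j ∈ I.clients A, α A j := by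
  obtain ⟨l, hl, h⟩ := farkas Finset.univ (homConstraint I)
    (homObjective I (facCost I s + connCost I s))
    fun z hz => homObjective_nonneg I s hs z fun k => hz k (Finset.mem_univ k)
  have h' : ∀ z : HomSol F D Scen,
      ∑ A, ∑ j ∈ I.clients A, l (.inr (.inr (.inr (.inr (.inl (A, j)))))) *
        (∑ i, z.2.2.1 A i j - z.2.2.2) +
      ∑ A, ∑ i, ∑ j ∈ I.clients A, l (.inr (.inr (.inr (.inr (.inr (A, i, j)))))) *
        (z.1 i + z.2.1 A i - z.2.2.1 A i j) +
      (∑ i, l (.inl i) * z.1 i + ∑ A, ∑ i, l (.inr (.inl (A, i))) * z.2.1 A i +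
        ∑ A, ∑ i, ∑ j, l (.inr (.inr (.inl (A, i, j)))) * z.2.2.1 A i j +
        l (.inr (.inr (.inr (.inl ())))) * z.2.2.2) =
      homObjective I (facCost I s + connCost I s) z := by
    intro z
    rw [h z]
    simp only [Fintype.sum_sum_type, Fintype.sum_prod_type, homConstraint]
    simp [HomSol.y₁, HomSol.y₂, HomSol.x, HomSol.t, LinearMap.sum_apply, apply_ite,
      Finset.sum_ite_mem, DFunLike.ite_apply]
    ring
  simp only [homObjective_apply] at h'
  refine ⟨fun A j => l (.inr (.inr (.inr (.inr (.inl (A, j)))))),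
    fun A i j => l (.inr (.inr (.inr (.inr (.inr (A, i, j)))))), fun _ _ => hl _, fun _ _ _ => hl _,
    fun A j hj i => ?_, fun i => ?_, fun A i => ?_, ?_⟩
  -- Unit vectors extract the coefficients of the Farkas identity. The nonnegative multipliers of
  -- the sign constraints act as slacks and turn the equations into inequalities.
  · have := h' (0, 0, fun A' i' j' => if A' = A then if i' = i then if j' = j then 1 else 0 else 0 else 0, 0)
    simp [facCost, connCost, Finset.sum_ite_irrel, hj] at this
    linarith [hl (.inr (.inr (.inl (A, i, j))))]
  · have := h' (fun i' => if i' = i then 1 else 0, 0, 0, 0)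
    simp [facCost, connCost] at this
    linarith [hl (.inl i)]
  · have := h' (0, fun A' i' => if A' = A then if i' = i then 1 else 0 else 0, 0, 0)
    simp [facCost, connCost] at this
    linarith [hl (.inr (.inl (A, i)))]
  · have := h' (0, 0, 0, 1)
    simp [facCost, connCost] at this
    simp only [facCost, connCost]
    linarith [hl (.inr (.inr (.inr (.inl ()))))]

/-- The primal dual gap is a sum of complementary slackness terms. -/
theorem sum_slack_le (I : Inst F D Scen) {s : Sol F D Scen} (hs : Feasible I s)
    {v : Scen → D → ℝ} {w : Scen → F → D → ℝ} (h : DualFeasible I v w) :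
    ∑ A, I.p A * ∑ j ∈ I.clients A, (v A j * (∑ i, s.x A i j - 1) +
      ∑ i, (I.c i j + w A i j - v A j) * s.x A i j) ≤
      facCost I s + connCost I s - dualValue I v := by
  obtain ⟨h1, h2, h3, h4⟩ := h
  have e : ∑ A, I.p A * ∑ j ∈ I.clients A, (v A j * (∑ i, s.x A i j - 1) +
      ∑ i, (I.c i j + w A i j - v A j) * s.x A i j) = connCost I s - dualValue I v +
      ∑ A, I.p A * ∑ j ∈ I.clients A, ∑ i, w A i j * s.x A i j := by
    rw [connCost, dualValue, ← Finset.sum_sub_distrib, ← Finset.sum_add_distrib]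
    refine Finset.sum_congr rfl fun A _ => ?_
    rw [← mul_sub, ← mul_add, ← Finset.sum_sub_distrib, ← Finset.sum_add_distrib]
    congr 1
    refine Finset.sum_congr rfl fun j _ => ?_
    simp only [sub_mul, add_mul, Finset.sum_add_distrib, Finset.sum_sub_distrib, ← Finset.mul_sum]
    ring
  -- Bound `x` by `y₁ + y₂`, regroup by facility, and let the dual packing constraints bound the
  -- coefficient of each opening variable.
  have hw : ∑ A, I.p A * ∑ j ∈ I.clients A, ∑ i, w A i j * s.x A i j ≤ facCost I s := by
    calc ∑ A, I.p A * ∑ j ∈ I.clients A, ∑ i, w A i j * s.x A i j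
        ≤ ∑ A, I.p A * ∑ j ∈ I.clients A, ∑ i, w A i j * (s.y₁ i + s.y₂ A i) := by
          refine Finset.sum_le_sum fun A _ => mul_le_mul_of_nonneg_left ?_ (I.p_nonneg A)
          refine Finset.sum_le_sum fun j hj => Finset.sum_le_sum fun i _ => ?_
          exact mul_le_mul_of_nonneg_left (((hs.2 A).2.2 j hj).2 i).2 ((h4 A j hj).2 i)
      _ = ∑ i, (∑ A, I.p A * ∑ j ∈ I.clients A, w A i j) * s.y₁ i +
          ∑ A, I.p A * ∑ i, (∑ j ∈ I.clients A, w A i j) * s.y₂ A i := by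
          simp only [mul_add, Finset.sum_add_distrib, Finset.sum_mul, mul_assoc]
          congr 1
          · rw [Finset.sum_comm]
            refine Finset.sum_congr rfl fun A _ => ?_
            rw [← Finset.mul_sum, Finset.sum_comm]
          · refine Finset.sum_congr rfl fun A _ => ?_
            rw [Finset.sum_comm]
      _ ≤ facCost I s := by
          refine add_le_add (Finset.sum_le_sum fun i _ =>
            mul_le_mul_of_nonneg_right (h2 i) (hs.1 i)) ?_
          refine Finset.sum_le_sum fun A _ => mul_le_mul_of_nonneg_left ?_ (I.p_nonneg A)
          exact Finset.sum_le_sum fun i _ =>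
            mul_le_mul_of_nonneg_right (h3 A i) ((hs.2 A).2.1 i)
  rw [e]
  linarith

theorem slack_nonneg (I : Inst F D Scen) {s : Sol F D Scen} (hs : Feasible I s)
    {v : Scen → D → ℝ} {w : Scen → F → D → ℝ} (h : DualFeasible I v w) (A : Scen) {j : D}
    (hj : j ∈ I.clients A) :
    0 ≤ v A j * (∑ i, s.x A i j - 1) ∧ ∀ i, 0 ≤ (I.c i j + w A i j - v A j) * s.x A i j := by
  refine ⟨mul_nonneg (h.2.2.2 A j hj).1 (sub_nonneg.2 ((hs.2 A).2.2 j hj).1), fun i => ?_⟩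
  exact mul_nonneg (by linarith [h.1 A j hj i]) (((hs.2 A).2.2 j hj).2 i).1

/-- Weak duality. -/
theorem dualValue_le (I : Inst F D Scen) {s : Sol F D Scen} (hs : Feasible I s)
    {v : Scen → D → ℝ} {w : Scen → F → D → ℝ} (h : DualFeasible I v w) :
    dualValue I v ≤ facCost I s + connCost I s := by
  have := sum_slack_le I hs h
  have : 0 ≤ ∑ A, I.p A * ∑ j ∈ I.clients A, (v A j * (∑ i, s.x A i j - 1) +
      ∑ i, (I.c i j + w A i j - v A j) * s.x A i j) :=
    Finset.sum_nonneg fun A _ => mul_nonneg (I.p_nonneg A) <| Finset.sum_nonneg fun j hj =>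
      add_nonneg (slack_nonneg I hs h A hj).1
        (Finset.sum_nonneg fun i _ => (slack_nonneg I hs h A hj).2 i)
  linarith

/-- **Strong duality.** -/
theorem exists_dualOptimal (I : Inst F D Scen) (s : Sol F D Scen) (hs : Optimal I s) :
    ∃ v w, DualOptimal I v w ∧ dualValue I v = facCost I s + connCost I s := by
  obtain ⟨α, β, hα, hβ, h1, h2, h3, h4⟩ := exists_multipliers I s hs
  -- The dual variables will be the multipliers divided by `p A`. In scenarios of probability zero
  -- Lean's division returns 0, which loses nothing provided the multipliers vanish there.
  have hz : ∀ A, I.p A = 0 → ∀ j ∈ I.clients A, (∀ i, β A i j = 0) := by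
    intro A hA j hj i
    have h := h3 A i
    rw [hA, zero_mul] at h
    exact (Finset.sum_eq_zero_iff_of_nonneg fun j _ => hβ A i j).1
      (le_antisymm h (Finset.sum_nonneg fun j _ => hβ A i j)) j hj
  have hpβ : ∀ A i, I.p A * ∑ j ∈ I.clients A, β A i j / I.p A = ∑ j ∈ I.clients A, β A i j := by
    intro A i
    rw [Finset.mul_sum]
    refine Finset.sum_congr rfl fun j hj => ?_
    by_cases hA : I.p A = 0
    · simp [hz A hA j hj i, hA]
    · exact mul_div_cancel₀ _ hA
  -- Needed for `α` when `p A = 0`: its only upper bound comes from a constraint indexed by a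
  -- facility. Without facilities, feasibility leaves no clients.
  have hF : Nonempty F ∨ ∀ A, I.clients A = ∅ := by
    by_cases hF : Nonempty F
    · exact Or.inl hF
    · refine Or.inr fun A => Finset.eq_empty_of_forall_notMem fun j hj => ?_
      rw [not_nonempty_iff] at hF
      have := ((hs.1.2 A).2.2 j hj).1
      simp at this
      linarith
  have hfe : DualFeasible I (fun A j => α A j / I.p A) (fun A i j => β A i j / I.p A) := by
    refine ⟨fun A j hj i => ?_, fun i => ?_, fun A i => ?_, fun A j hj =>
      ⟨div_nonneg (hα A j) (I.p_nonneg A), fun i => div_nonneg (hβ A i j) (I.p_nonneg A)⟩⟩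
    · rcases (I.p_nonneg A).eq_or_lt with hA | hA
      · simp [← hA, I.c_nonneg]
      · have := h1 A j hj i
        simp only
        rw [sub_le_iff_le_add', ← sub_le_iff_le_add, ← sub_div, div_le_iff₀ hA]
        linarith
    · simpa only [hpβ] using h2 i
    · rcases (I.p_nonneg A).eq_or_lt with hA | hA
      · simp [← hA, I.f₂_nonneg]
      · simp only
        rw [← Finset.sum_div, div_le_iff₀ hA]
        linarith [h3 A i]
  have hval : facCost I s + connCost I s ≤ dualValue I (fun A j => α A j / I.p A) := by
    refine h4.trans (Finset.sum_le_sum fun A _ => ?_)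
    rw [Finset.mul_sum]
    refine Finset.sum_le_sum fun j hj => ?_
    by_cases hA : I.p A = 0
    · rcases hF with ⟨⟨i⟩⟩ | hF
      · have := h1 A j hj i
        rw [hz A hA j hj i, hA] at this
        simp only [hA, zero_mul]
        linarith
      · simp [hF] at hj
    · exact (mul_div_cancel₀ _ hA).ge
  exact ⟨_, _, ⟨hfe, fun v' w' h' => (dualValue_le I hs.1 h').trans hval⟩,
    le_antisymm (dualValue_le I hs.1 hfe) hval⟩

theorem dualValue_eq (I : Inst F D Scen) {s : Sol F D Scen} (hs : Optimal I s)
    {v : Scen → D → ℝ} {w : Scen → F → D → ℝ} (h : DualOptimal I v w) :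
    dualValue I v = facCost I s + connCost I s := by
  obtain ⟨v', w', h', e⟩ := exists_dualOptimal I s hs
  exact le_antisymm (dualValue_le I hs.1 h.1) (e ▸ h.2 v' w' h'.1)

/-- **Complementary slackness.** -/
theorem complementary_slackness (I : Inst F D Scen) {s : Sol F D Scen} (hs : Optimal I s)
    {v : Scen → D → ℝ} {w : Scen → F → D → ℝ} (h : DualOptimal I v w) {A : Scen}
    (hA : 0 < I.p A) {j : D} (hj : j ∈ I.clients A) :
    (v A j ≠ 0 → ∑ i, s.x A i j = 1) ∧ ∀ i, s.x A i j ≠ 0 → I.c i j ≤ v A j := by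
  have h0 := sum_slack_le I hs.1 h.1
  rw [dualValue_eq I hs h, sub_self] at h0
  have hn := slack_nonneg I hs.1 h.1
  have hn2 : ∀ A, ∀ j ∈ I.clients A, 0 ≤ v A j * (∑ i, s.x A i j - 1) +
      ∑ i, (I.c i j + w A i j - v A j) * s.x A i j := fun A j hj =>
    add_nonneg (hn A hj).1 (Finset.sum_nonneg fun i _ => (hn A hj).2 i)
  have hn3 : ∀ A ∈ Finset.univ, 0 ≤ I.p A * ∑ j ∈ I.clients A, (v A j * (∑ i, s.x A i j - 1) +
      ∑ i, (I.c i j + w A i j - v A j) * s.x A i j) := fun A _ =>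
    mul_nonneg (I.p_nonneg A) (Finset.sum_nonneg (hn2 A))
  have h1 := (Finset.sum_eq_zero_iff_of_nonneg hn3).1
    (le_antisymm h0 (Finset.sum_nonneg hn3)) A (Finset.mem_univ A)
  have h2 := (Finset.sum_eq_zero_iff_of_nonneg (hn2 A)).1
    ((mul_eq_zero.1 h1).resolve_left hA.ne') j hj
  have h3 : ∑ i, (I.c i j + w A i j - v A j) * s.x A i j = 0 := by
    have := Finset.sum_nonneg fun i (_ : i ∈ Finset.univ) => (hn A hj).2 i
    linarith [(hn A hj).1]
  refine ⟨fun hv => ?_, fun i hi => ?_⟩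
  · rw [h3, add_zero] at h2
    linarith [(mul_eq_zero.1 h2).resolve_left hv]
  · have h4 := (Finset.sum_eq_zero_iff_of_nonneg fun i _ => (hn A hj).2 i).1 h3 i
      (Finset.mem_univ i)
    linarith [(mul_eq_zero.1 h4).resolve_right hi, (h.1.2.2.2 A j hj).2 i]

end Duality

/-! ### Distribution of the opened copies in one stage -/

section Outcomes

variable {G : Type*} [Fintype G]

open Classical in
/-- The total weight of all outcomes, when a cluster opens exactly one of its elements `g` with
weight `z g`, and an unclustered `g` is open with weight `z g` and closed with weight `b g`. -/
theorem sum_outcome_weight (z b : G → ℝ) (𝒞 : Finset (Finset G))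
    (hd : ∀ K ∈ 𝒞, ∀ K' ∈ 𝒞, K ≠ K' → Disjoint K K') :
    ∑ O : Finset G, (∏ K ∈ 𝒞, if (O ∩ K).card = 1 then ∑ g ∈ O ∩ K, z g else 0) *
      ∏ g with ∀ K ∈ 𝒞, g ∉ K, (if g ∈ O then z g else b g) =
    (∏ K ∈ 𝒞, ∑ g ∈ K, z g) * ∏ g with ∀ K ∈ 𝒞, g ∉ K, (z g + b g) := by
  -- Only subsets of the unclustered elements and of the clusters in `𝒦` are summed. Adding a
  -- cluster `K` then splits an outcome uniquely into `Q ⊆ K` and the rest, so a factor for `K`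
  -- comes out.
  have key : ∀ 𝒦 : Finset (Finset G), 𝒦 ⊆ 𝒞 →
      ∑ O ∈ ((Finset.univ.filter fun g => ∀ K ∈ 𝒞, g ∉ K) ∪ 𝒦.biUnion id).powerset,
        (∏ K ∈ 𝒦, if (O ∩ K).card = 1 then ∑ g ∈ O ∩ K, z g else 0) *
          ∏ g with ∀ K ∈ 𝒞, g ∉ K, (if g ∈ O then z g else b g) =
        (∏ K ∈ 𝒦, ∑ g ∈ K, z g) * ∏ g with ∀ K ∈ 𝒞, g ∉ K, (z g + b g) := by
    intro 𝒦
    induction 𝒦 using Finset.induction_on with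
    | empty =>
      intro _
      have h := Finset.prod_add (fun g => z g) (fun g => b g)
        (Finset.univ.filter fun g => ∀ K ∈ 𝒞, g ∉ K)
      simp only [Finset.biUnion_empty, Finset.union_empty, Finset.prod_empty, one_mul]
      refine Eq.trans ?_ h.symm
      refine Finset.sum_congr rfl fun O hO => ?_
      rw [Finset.prod_ite]
      congr 1
      · refine Finset.prod_congr ?_ fun _ _ => rfl
        ext g
        have := @Finset.mem_powerset.1 hO g
        simp only [Finset.mem_filter, Finset.mem_univ, true_and] at this ⊢
        tauto
      · refine Finset.prod_congr ?_ fun _ _ => rfl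
        ext g
        simp only [Finset.mem_filter, Finset.mem_sdiff]
    | insert K 𝒦 hK ih =>
      intro hsub
      have hK' : K ∈ 𝒞 := hsub (Finset.mem_insert_self _ _)
      have h𝒦 : 𝒦 ⊆ 𝒞 := fun L hL => hsub (Finset.mem_insert_of_mem hL)
      have ih := ih h𝒦
      set U := Finset.univ.filter fun g => ∀ K ∈ 𝒞, g ∉ K with hU
      have hdis : Disjoint K (U ∪ 𝒦.biUnion id) := by
        rw [Finset.disjoint_union_right, Finset.disjoint_biUnion_right]
        refine ⟨?_, fun L hL => hd K hK' L (h𝒦 hL) fun h => hK (h ▸ hL)⟩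
        rw [Finset.disjoint_left]
        intro g hg hgU
        exact (Finset.mem_filter.1 hgU).2 K hK' hg
      have e : U ∪ (insert K 𝒦).biUnion id = K ∪ (U ∪ 𝒦.biUnion id) := by
        rw [Finset.biUnion_insert]; simp only [id]; ac_rfl
      have hone : ∑ Q ∈ K.powerset, (if Q.card = 1 then ∑ g ∈ Q, z g else 0) =
          ∑ g ∈ K, z g := by
        rw [← Finset.sum_filter, ← Finset.powersetCard_eq_filter, Finset.powersetCard_one,
          Finset.sum_map]
        simp
      rw [e]
      trans ∑ q ∈ K.powerset ×ˢ (U ∪ 𝒦.biUnion id).powerset,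
        (if q.1.card = 1 then ∑ g ∈ q.1, z g else 0) *
        ((∏ K ∈ 𝒦, if (q.2 ∩ K).card = 1 then ∑ g ∈ q.2 ∩ K, z g else 0) *
          ∏ g ∈ U, (if g ∈ q.2 then z g else b g))
      · symm
        refine Finset.sum_bij' (fun q _ => q.1 ∪ q.2)
          (fun O _ => (O ∩ K, O ∩ (U ∪ 𝒦.biUnion id))) ?_ ?_ ?_ ?_ ?_
        · rintro ⟨Q, O⟩ h
          rw [Finset.mem_product, Finset.mem_powerset, Finset.mem_powerset] at h
          exact Finset.mem_powerset.2 (Finset.union_subset_union h.1 h.2)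
        · intro O _
          exact Finset.mem_product.2 ⟨Finset.mem_powerset.2 Finset.inter_subset_right,
            Finset.mem_powerset.2 Finset.inter_subset_right⟩
        · rintro ⟨Q, O⟩ h
          rw [Finset.mem_product, Finset.mem_powerset, Finset.mem_powerset] at h
          have h1 := Finset.disjoint_of_subset_left h.1 hdis
          have h2 := Finset.disjoint_of_subset_right h.2 hdis
          simp only [Prod.mk.injEq]
          rw [Finset.union_inter_distrib_right, Finset.union_inter_distrib_right,
            Finset.inter_eq_left.2 h.1, Finset.inter_eq_left.2 h.2,
            Finset.disjoint_iff_inter_eq_empty.1 h1, Finset.disjoint_iff_inter_eq_empty.1 h2.symm]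
          simp
        · intro O h
          simp only
          rw [← Finset.inter_union_distrib_left, Finset.inter_eq_left]
          exact Finset.mem_powerset.1 h
        · rintro ⟨Q, O⟩ h
          rw [Finset.mem_product, Finset.mem_powerset, Finset.mem_powerset] at h
          have h2 := Finset.disjoint_of_subset_right h.2 hdis
          simp only
          rw [Finset.prod_insert hK, mul_assoc]
          have eK : (Q ∪ O) ∩ K = Q := by
            rw [Finset.union_inter_distrib_right, Finset.inter_eq_left.2 h.1,
              Finset.disjoint_iff_inter_eq_empty.1 h2.symm, Finset.union_empty]
          rw [eK]
          congr 2
          · refine Finset.prod_congr rfl fun L hL => ?_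
            have : (Q ∪ O) ∩ L = O ∩ L := by
              have h3 : Disjoint Q L := Finset.disjoint_of_subset_left h.1
                (hd K hK' L (h𝒦 hL) fun h => hK (h ▸ hL))
              rw [Finset.union_inter_distrib_right, Finset.disjoint_iff_inter_eq_empty.1 h3,
                Finset.empty_union]
            rw [this]
          · refine Finset.prod_congr rfl fun g hg => ?_
            have : g ∉ Q := fun hq => (Finset.mem_filter.1 hg).2 K hK' (h.1 hq)
            simp [this]
      · rw [Finset.sum_product]
        simp only
        simp_rw [← Finset.mul_sum, ih, ← Finset.sum_mul]
        rw [hone, Finset.prod_insert hK, mul_assoc]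
  have h := key 𝒞 (Finset.Subset.refl _)
  have hu : (Finset.univ.filter fun g => ∀ K ∈ 𝒞, g ∉ K) ∪ 𝒞.biUnion id = Finset.univ := by
    ext g
    simp only [Finset.mem_union, Finset.mem_filter, Finset.mem_univ, true_and, Finset.mem_biUnion,
      id, iff_true]
    by_cases hg : ∃ K ∈ 𝒞, g ∈ K
    · exact Or.inr hg
    · push Not at hg
      exact Or.inl hg
  rw [hu, Finset.powerset_univ] at h
  exact h


open Classical in
theorem openProb_nonneg {z : G → ℝ} (h0 : ∀ g, 0 ≤ z g) (h1 : ∀ g, z g ≤ 1)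
    (𝒞 : Finset (Finset G)) (O : Finset G) : 0 ≤ openProb z 𝒞 O := by
  refine mul_nonneg (Finset.prod_nonneg fun K _ => ?_) (Finset.prod_nonneg fun g _ => ?_)
  · split_ifs
    exacts [Finset.sum_nonneg fun g _ => h0 g, le_rfl]
  · split_ifs
    exacts [h0 g, sub_nonneg.2 (h1 g)]

open Classical in
/-- An outcome of positive probability opens an element of each cluster. -/
theorem exists_mem_of_openProb_ne_zero {z : G → ℝ} {𝒞 : Finset (Finset G)} {O : Finset G}
    (h : openProb z 𝒞 O ≠ 0) {K : Finset G} (hK : K ∈ 𝒞) : ∃ g ∈ O, g ∈ K := by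
  have h1 := Finset.prod_ne_zero_iff.1 (left_ne_zero_of_mul h) K hK
  have h2 : (O ∩ K).card = 1 := by
    by_contra h2
    simp [h2] at h1
  obtain ⟨g, hg⟩ := Finset.card_pos.1 (h2 ▸ Nat.one_pos)
  exact ⟨g, (Finset.mem_inter.1 hg).1, (Finset.mem_inter.1 hg).2⟩

open Classical in
/-- The probability that no element of `T` is opened. -/
theorem openProb_miss (z : G → ℝ) (𝒞 : Finset (Finset G))
    (hd : ∀ K ∈ 𝒞, ∀ K' ∈ 𝒞, K ≠ K' → Disjoint K K') (T : Finset G) :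
    ∑ O with Disjoint O T, openProb z 𝒞 O =
      (∏ K ∈ 𝒞, ∑ g ∈ K \ T, z g) * ∏ g ∈ T with ∀ K ∈ 𝒞, g ∉ K, (1 - z g) := by
  -- Giving opened members of `T` weight zero, with closing weights unchanged, kills exactly the
  -- outcomes that meet `T`.
  have h := sum_outcome_weight (fun g => if g ∈ T then 0 else z g) (fun g => 1 - z g) 𝒞 hd
  have e1 : ∀ K : Finset G, ∑ g ∈ K, (if g ∈ T then 0 else z g) = ∑ g ∈ K \ T, z g := fun K => by
    rw [Finset.sum_ite, Finset.sum_const_zero, zero_add, Finset.sdiff_eq_filter]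
  have e2 : ∏ g with ∀ K ∈ 𝒞, g ∉ K, ((if g ∈ T then 0 else z g) + (1 - z g)) =
      ∏ g ∈ T with ∀ K ∈ 𝒞, g ∉ K, (1 - z g) := by
    have : ∀ g, ((if g ∈ T then 0 else z g) + (1 - z g)) = if g ∈ T then 1 - z g else 1 :=
      fun g => by split_ifs <;> ring
    simp only [this]
    rw [← Finset.prod_filter, Finset.filter_filter]
    refine Finset.prod_congr ?_ fun _ _ => rfl
    ext g
    simp only [Finset.mem_filter, Finset.mem_univ, true_and]
    tauto
  rw [e2] at h
  simp only [e1] at h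
  rw [← h, Finset.sum_filter]
  refine Finset.sum_congr rfl fun O _ => ?_
  split_ifs with hO
  · rw [openProb]
    congr 1
    · refine Finset.prod_congr rfl fun K _ => ?_
      rw [(Finset.sdiff_eq_self_iff_disjoint (s := O ∩ K) (t := T)).2
        (Finset.disjoint_of_subset_left Finset.inter_subset_left hO)]
    · refine Finset.prod_congr rfl fun g _ => ?_
      by_cases hg : g ∈ O
      · simp [hg, Finset.disjoint_left.1 hO hg]
      · simp [hg]
  · obtain ⟨g, hgO, hgT⟩ := Finset.not_disjoint_iff.1 hO
    symm
    by_cases hg : ∀ K ∈ 𝒞, g ∉ K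
    · rw [mul_eq_zero]
      right
      refine Finset.prod_eq_zero (i := g) (by simpa using hg) ?_
      simp [hgO, hgT]
    · push Not at hg
      obtain ⟨K, hK, hgK⟩ := hg
      rw [mul_eq_zero]
      left
      refine Finset.prod_eq_zero hK ?_
      split_ifs with hc
      · obtain ⟨g', hg'⟩ := Finset.card_eq_one.1 hc
        have : g ∈ O ∩ K := Finset.mem_inter.2 ⟨hgO, hgK⟩
        rw [hg', Finset.mem_singleton] at this
        rw [hg', ← this, Finset.sdiff_eq_empty_iff_subset.2 (by simpa using hgT), Finset.sum_empty]
      · rfl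

-- Each cluster misses `T` with probability `1 - t`, where `t` is its opening inside `T`, and each
-- unclustered member `g` of `T` stays closed with probability `1 - z g`. Use `1 - t ≤ exp (-t)`
-- factor by factor. Clustering therefore does no harm compared with independent opening.
open Classical in
theorem openProb_miss_le_exp {z : G → ℝ} (h0 : ∀ g, 0 ≤ z g) (h1 : ∀ g, z g ≤ 1)
    {𝒞 : Finset (Finset G)}
    (hd : ∀ K ∈ 𝒞, ∀ K' ∈ 𝒞, K ≠ K' → Disjoint K K') (hz : ∀ K ∈ 𝒞, ∑ g ∈ K, z g = 1)
    (T : Finset G) :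
    ∑ O with Disjoint O T, openProb z 𝒞 O ≤ Real.exp (-∑ g ∈ T, z g) := by
  rw [openProb_miss z 𝒞 hd]
  have hsplit : ∑ g ∈ T, z g = ∑ K ∈ 𝒞, ∑ g ∈ K ∩ T, z g + ∑ g ∈ T with ∀ K ∈ 𝒞, g ∉ K, z g := by
    rw [← Finset.sum_filter_not_add_sum_filter T (fun g => ∀ K ∈ 𝒞, g ∉ K)]
    congr 1
    rw [← Finset.sum_biUnion]
    · refine Finset.sum_congr ?_ fun _ _ => rfl
      ext g
      simp only [Finset.mem_filter, Finset.mem_biUnion, Finset.mem_inter]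
      push Not
      tauto
    · intro K hK K' hK' hne
      exact Finset.disjoint_of_subset_left Finset.inter_subset_left
        (Finset.disjoint_of_subset_right Finset.inter_subset_left (hd K hK K' hK' hne))
  rw [hsplit, neg_add, Real.exp_add, ← Finset.sum_neg_distrib, ← Finset.sum_neg_distrib,
    Real.exp_sum, Real.exp_sum]
  have hb : ∀ t : ℝ, 1 - t ≤ Real.exp (-t) := fun t => by linarith [Real.add_one_le_exp (-t)]
  refine mul_le_mul (Finset.prod_le_prod (fun K _ => Finset.sum_nonneg fun g _ => h0 g)
    fun K hK => ?_) (Finset.prod_le_prod (fun g _ => sub_nonneg.2 (h1 g)) fun g _ => hb _)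
    (Finset.prod_nonneg fun g _ => sub_nonneg.2 (h1 g))
    (Finset.prod_nonneg fun K _ => (Real.exp_pos _).le)
  have := Finset.sum_inter_add_sum_sdiff K T z
  linarith [hb (∑ g ∈ K ∩ T, z g), hz K hK]

open Classical in
/-- The probability that `g` is opened. -/
theorem openProb_hit_singleton {z : G → ℝ} {𝒞 : Finset (Finset G)}
    (hd : ∀ K ∈ 𝒞, ∀ K' ∈ 𝒞, K ≠ K' → Disjoint K K') (hz : ∀ K ∈ 𝒞, ∑ g ∈ K, z g = 1) (g : G) :
    ∑ O with g ∈ O, openProb z 𝒞 O = z g := by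
  have hm := openProb_miss z 𝒞 hd {g}
  have ht := openProb_sum z 𝒞 hd hz
  rw [← Finset.sum_filter_not_add_sum_filter _ (fun O : Finset G => Disjoint O {g}), hm] at ht
  simp only [Finset.disjoint_singleton_right, not_not] at ht
  suffices h : (∏ K ∈ 𝒞, ∑ g' ∈ K \ {g}, z g') * ∏ g' ∈ {g} with ∀ K ∈ 𝒞, g' ∉ K, (1 - z g') =
      1 - z g by linarith
  by_cases hg : ∀ K ∈ 𝒞, g ∉ K
  · rw [Finset.filter_true_of_mem (by simpa using hg), Finset.prod_singleton,
      Finset.prod_eq_one fun K hK => ?_, one_mul]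
    rw [Finset.sdiff_eq_self_of_disjoint (by simpa using hg K hK), hz K hK]
  · rw [Finset.filter_false_of_mem (by simpa using hg), Finset.prod_empty, mul_one]
    push Not at hg
    obtain ⟨K, hK, hgK⟩ := hg
    rw [Finset.prod_eq_single_of_mem K hK fun K' hK' hne => ?_]
    · rw [← hz K hK, Finset.sum_eq_sum_sdiff_singleton_add hgK]
      ring
    · rw [Finset.sdiff_eq_self_of_disjoint
        (by simpa using Finset.disjoint_left.1 (hd K hK K' hK' hne.symm) hgK),
        hz K' hK']

end Outcomes

/-! ### From hitting probabilities to expectations -/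

section Layers

open Classical in
/-- If every `T ⊆ S` is hit with probability at least `r` times its total weight, then the expected
value of the best member of `S` that is hit is at least `r` times the weighted sum of all
values. -/
theorem sum_le_of_hit {Ω G : Type*} [Fintype Ω] {μ : Ω → ℝ} (hμ : ∀ ω, 0 ≤ μ ω)
    (O : Ω → Finset G) (z : G → ℝ) (r : ℝ) (S : Finset G) :
    (∀ T ⊆ S, r * ∑ g ∈ T, z g ≤ ∑ ω with ¬ Disjoint (O ω) T, μ ω) →
    ∀ (a : G → ℝ) (φ : Ω → ℝ), (∀ g ∈ S, 0 ≤ a g) → (∀ ω, μ ω ≠ 0 → 0 ≤ φ ω) →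
      (∀ ω, μ ω ≠ 0 → ∀ g ∈ S, g ∈ O ω → a g ≤ φ ω) →
      r * ∑ g ∈ S, z g * a g ≤ ∑ ω, μ ω * φ ω := by
  induction S using Finset.strongInduction with
  | H S ih =>
    intro hT a φ ha hφ haφ
    have hpos : ∀ ψ : Ω → ℝ, (∀ ω, μ ω ≠ 0 → 0 ≤ ψ ω) → ∀ ω, 0 ≤ μ ω * ψ ω := fun ψ hψ ω => by
      by_cases h : μ ω = 0
      · simp [h]
      · exact mul_nonneg (hμ ω) (hψ ω h)
    rcases S.eq_empty_or_nonempty with rfl | hS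
    · simpa using Finset.sum_nonneg fun ω _ => hpos φ hφ ω
    -- Peel off the lowest layer: subtract `a g₀` from all values, and from `φ` on the outcomes that
    -- hit `S`. Then `g₀` has value zero and can be dropped, while the removed layer is controlled
    -- by the hitting hypothesis for `S` itself.
    obtain ⟨g₀, hg₀, hmin⟩ := S.exists_min_image a hS
    have := ih (S.erase g₀) (Finset.erase_ssubset hg₀)
      (fun T hT' => hT T (hT'.trans (Finset.erase_subset _ _))) (fun g => a g - a g₀)
      (fun ω => φ ω - if Disjoint (O ω) S then 0 else a g₀)
      (fun g hg => sub_nonneg.2 (hmin g (Finset.mem_of_mem_erase hg)))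
      (fun ω hω => by
        split_ifs with h
        · simpa using hφ ω hω
        · obtain ⟨g, hgO, hgS⟩ := Finset.not_disjoint_iff.1 h
          exact sub_nonneg.2 ((hmin g hgS).trans (haφ ω hω g hgS hgO)))
      (fun ω hω g hg hgO => by
        have hgS := Finset.mem_of_mem_erase hg
        rw [if_neg (Finset.not_disjoint_iff.2 ⟨g, hgO, hgS⟩)]
        exact sub_le_sub_right (haφ ω hω g hgS hgO) _)
    have e1 : ∑ g ∈ S.erase g₀, z g * (a g - a g₀) = ∑ g ∈ S, z g * a g - (∑ g ∈ S, z g) * a g₀ := by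
      rw [Finset.sum_erase _ (by simp), Finset.sum_mul, ← Finset.sum_sub_distrib]
      exact Finset.sum_congr rfl fun g _ => by ring
    have e2 : ∑ ω, μ ω * (φ ω - if Disjoint (O ω) S then 0 else a g₀) =
        ∑ ω, μ ω * φ ω - (∑ ω with ¬ Disjoint (O ω) S, μ ω) * a g₀ := by
      rw [Finset.sum_filter, Finset.sum_mul, ← Finset.sum_sub_distrib]
      refine Finset.sum_congr rfl fun ω _ => ?_
      rw [ite_not]
      split_ifs <;> ring
    rw [e1, e2] at this
    have h2 := mul_le_mul_of_nonneg_right (hT S subset_rfl) (ha g₀ hg₀)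
    linarith

/-- The chord of `1 - exp (-u)` over `[0, 2]`. -/
theorem chord_le_one_sub_exp {u : ℝ} (h0 : 0 ≤ u) (h2 : u ≤ 2) :
    (1 - Real.exp (-2)) / 2 * u ≤ 1 - Real.exp (-u) := by
  have h := convexOn_exp.2 (Set.mem_univ 0) (Set.mem_univ (-2))
    (show 0 ≤ 1 - u / 2 by linarith) (show 0 ≤ u / 2 by linarith) (by ring)
  simp only [smul_eq_mul, mul_zero, Real.exp_zero, zero_add] at h
  rw [show u / 2 * -2 = -u by ring] at h
  linarith

end Layers

/-! ### Existence of splittings and runs -/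

section Existence

/-- Positive increments between consecutive members of a finite set of positive numbers. -/
theorem exists_increments (B : Finset ℝ) : (∀ b ∈ B, 0 < b) →
    ∃ δ : ℝ → ℝ, (∀ b ∈ B, 0 < δ b) ∧ ∀ t ∈ B, ∑ b ∈ B with b ≤ t, δ b = t := by
  induction B using Finset.induction_on_max with
  | empty => exact fun _ => ⟨fun _ => 1, by simp, by simp⟩
  | insert m B hm ih =>
    intro hB
    obtain ⟨δ, h1, h2⟩ := ih fun b hb => hB b (Finset.mem_insert_of_mem hb)
    have hmB : m ∉ B := fun h => lt_irrefl _ (hm m h)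
    have hne : ∀ b ∈ B, b ≠ m := fun b hb => (hm b hb).ne
    have hlt : ∑ b ∈ B, δ b < m := by
      rcases B.eq_empty_or_nonempty with rfl | hBn
      · simpa using hB m (by simp)
      · have := h2 _ (B.max'_mem hBn)
        rw [Finset.filter_true_of_mem fun b hb => B.le_max' b hb] at this
        rw [this]
        exact hm _ (B.max'_mem hBn)
    have hu : ∀ S ⊆ B, ∑ b ∈ S, Function.update δ m (m - ∑ b ∈ B, δ b) b = ∑ b ∈ S, δ b :=
      fun S hS => Finset.sum_congr rfl fun b hb => Function.update_of_ne (hne b (hS hb)) _ _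
    refine ⟨Function.update δ m (m - ∑ b ∈ B, δ b), fun b hb => ?_, fun t ht => ?_⟩
    · rcases Finset.mem_insert.1 hb with rfl | hb
      · simpa using hlt
      · rw [Function.update_of_ne (hne b hb)]
        exact h1 b hb
    · rcases Finset.mem_insert.1 ht with rfl | ht
      · rw [Finset.filter_true_of_mem fun b hb => ?_, Finset.sum_insert hmB, hu B subset_rfl,
          Function.update_self]
        · ring
        · rcases Finset.mem_insert.1 hb with rfl | hb
          exacts [le_rfl, (hm b hb).le]
      · rw [Finset.filter_insert, if_neg (not_le.2 (hm t ht)), hu _ (Finset.filter_subset _ _)]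
        exact h2 t ht

open Classical in
/-- The facilities can be split into copies of opening at most one in such a way that every
opening vector from a finite list is attained by a set of copies. -/
theorem exists_copies {F Q : Type*} [Fintype F] [Fintype Q] (Y : F → ℝ) (θ : Q → F → ℝ)
    (hY : ∀ i, 0 ≤ Y i) (hθ : ∀ q i, 0 ≤ θ q i) :
    ∃ (n : ℕ) (fac : Fin n → F) (z : Fin n → ℝ) (lev : (F → ℝ) → Finset (Fin n)),
      (∀ g, 0 < z g) ∧ (∀ g, z g ≤ 1) ∧ Monotone lev ∧
      (∀ i, ∑ g with fac g = i, z g = Y i) ∧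
      ∀ q, θ q ≤ Y → ∀ i, ∑ g ∈ lev (θ q) with fac g = i, z g = θ q i := by
  -- All positive values that occur serve as common breakpoints. Each facility's interval `[0, Y i]`
  -- is cut at those up to `Y i`, so each prescribed opening becomes an initial union of pieces.
  set B : Finset ℝ := ((Finset.univ.image Y) ∪
    (Finset.univ.image fun p : Q × F => θ p.1 p.2)).filter (0 < ·) with hBdef
  have hB : ∀ b ∈ B, 0 < b := fun b hb => (Finset.mem_filter.1 hb).2
  have hYB : ∀ i, Y i = 0 ∨ Y i ∈ B := fun i => by
    rcases (hY i).eq_or_lt with h | h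
    · exact Or.inl h.symm
    · exact Or.inr (by simp [hBdef, h])
  have hθB : ∀ q i, θ q i = 0 ∨ θ q i ∈ B := fun q i => by
    rcases (hθ q i).eq_or_lt with h | h
    · exact Or.inl h.symm
    · refine Or.inr ?_
      rw [hBdef, Finset.mem_filter, Finset.mem_union]
      exact ⟨Or.inr (Finset.mem_image.2 ⟨(q, i), Finset.mem_univ _, rfl⟩), h⟩
  obtain ⟨δ, hδ0, hδ⟩ := exists_increments B hB
  -- Every piece is cut further into `N` equal copies, which forces the openings below one.
  obtain ⟨N, hN⟩ := exists_nat_gt (∑ b ∈ B, δ b)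
  have hN0 : (0 : ℝ) < N := (Finset.sum_nonneg fun b hb => (hδ0 b hb).le).trans_lt hN
  set C : Finset (F × ℝ × Fin N) :=
    (Finset.univ ×ˢ B ×ˢ Finset.univ).filter fun p => p.2.1 ≤ Y p.1 with hC
  have hCB : ∀ p ∈ C, p.2.1 ∈ B := fun p hp => by
    simp only [hC, Finset.mem_filter, Finset.mem_product] at hp
    exact hp.1.2.1
  have hCY : ∀ p ∈ C, p.2.1 ≤ Y p.1 := fun p hp => (Finset.mem_filter.1 hp).2
  set e := C.equivFin.symm
  have hsum : ∀ θ' : F → ℝ, θ' ≤ Y → ∀ i, (θ' i = 0 ∨ θ' i ∈ B) →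
      ∑ g with (e g).1.2.1 ≤ θ' (e g).1.1 ∧ (e g).1.1 = i, δ (e g).1.2.1 / N = θ' i := by
    intro θ' hle i hi
    have e1 : ∑ g with (e g).1.2.1 ≤ θ' (e g).1.1 ∧ (e g).1.1 = i, δ (e g).1.2.1 / N =
        ∑ p ∈ C, if p.2.1 ≤ θ' p.1 ∧ p.1 = i then δ p.2.1 / N else 0 := by
      rw [Finset.sum_filter, ← Finset.sum_coe_sort C]
      exact Equiv.sum_comp e
        fun p : C => if p.1.2.1 ≤ θ' p.1.1 ∧ p.1.1 = i then δ p.1.2.1 / N else 0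
    have e2 : ∑ p ∈ C, (if p.2.1 ≤ θ' p.1 ∧ p.1 = i then δ p.2.1 / N else 0) =
        ∑ i' : F, ∑ b ∈ B, ∑ _k : Fin N, if b ≤ θ' i' ∧ i' = i then δ b / N else 0 := by
      rw [← Finset.sum_filter, hC, Finset.filter_filter, Finset.sum_filter, Finset.sum_product]
      refine Finset.sum_congr rfl fun i' _ => ?_
      rw [Finset.sum_product]
      refine Finset.sum_congr rfl fun b _ => Finset.sum_congr rfl fun k _ => ?_
      refine if_congr ?_ rfl rfl
      exact ⟨fun h => h.2, fun h => ⟨h.1.trans (hle i'), h⟩⟩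
    rw [e1, e2, Finset.sum_eq_single i]
    · have e3 : ∀ b, ∑ _k : Fin N, (if b ≤ θ' i then δ b / N else 0) =
          if b ≤ θ' i then δ b else 0 := fun b => by
        rw [Finset.sum_const, Finset.card_univ, Fintype.card_fin, nsmul_eq_mul]
        split_ifs
        · field_simp
        · simp
      simp only [and_true, e3]
      rw [← Finset.sum_filter]
      rcases hi with hi | hi
      · rw [hi, Finset.filter_false_of_mem fun b hb => not_le.2 (hB b hb), Finset.sum_empty]
      · exact hδ _ hi
    · intro i' _ hne
      simp [hne]
    · simp
  refine ⟨C.card, fun g => (e g).1.1, fun g => δ (e g).1.2.1 / N,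
    fun θ' => Finset.univ.filter fun g => (e g).1.2.1 ≤ θ' (e g).1.1, fun g => ?_, fun g => ?_,
    ?_, fun i => ?_, fun q hq i => ?_⟩
  · exact div_pos (hδ0 _ (hCB _ (e g).2)) hN0
  · rw [div_le_one hN0]
    exact (Finset.single_le_sum (fun b hb => (hδ0 b hb).le) (hCB _ (e g).2)).trans hN.le
  · intro θ₁ θ₂ h g hg
    simp only [Finset.mem_filter, Finset.mem_univ, true_and] at hg ⊢
    exact hg.trans (h _)
  · rw [← hsum Y le_rfl i (hYB i)]
    refine Finset.sum_congr ?_ fun _ _ => rfl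
    ext g
    have := hCY _ (e g).2
    simp only [Finset.mem_filter, Finset.mem_univ, true_and]
    exact ⟨fun h => ⟨this, h⟩, fun h => h.2⟩
  · rw [← hsum (θ q) hq i (hθB q i), Finset.filter_filter]

/-- Besides `X q`, the splitting must realize `U q`, which is `X q` scaled to total one. For
selected `q` the scaling only shrinks, so monotonicity of the level sets makes the candidate a
subset of the serving copies. Sorting by radius supplies the order. -/
theorem exists_stageRun {F P : Type*} [Fintype F] [Fintype P] (Y : F → ℝ) (X : P → F → ℝ)
    (Sel : P → Prop) (d : P → F → ℝ) (hY : ∀ i, 0 ≤ Y i) (hX : ∀ q i, 0 ≤ X q i)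
    (hXY : ∀ q i, X q i ≤ Y i) (hSel : ∀ q, Sel q → 1 ≤ ∑ i, X q i) :
    Nonempty (StageRun Y X Sel d) := by
  classical
  set U : P → F → ℝ := fun q i => X q i / ∑ i, X q i with hU
  obtain ⟨n, fac, z, lev, hz0, hz1, hmono, hsumY, hsum⟩ := exists_copies (Q := P ⊕ P) Y
    (Sum.elim X U) hY (by
      rintro (q | q) i
      · exact hX q i
      · exact div_nonneg (hX q i) (Finset.sum_nonneg fun i _ => hX q i))
  have hsumX : ∀ q i, ∑ g ∈ lev (X q) with fac g = i, z g = X q i :=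
    fun q i => hsum (.inl q) (hXY q) i
  have hUX : ∀ q, Sel q → U q ≤ X q := fun q hq i => div_le_self (hX q i) (hSel q hq)
  have hsumU : ∀ q, Sel q → ∀ i, ∑ g ∈ lev (U q) with fac g = i, z g = U q i :=
    fun q hq i => hsum (.inr q) ((hUX q hq).trans (hXY q)) i
  let S : Splitting Y X Sel :=
    { n := n
      fac := fac
      z := z
      z_pos := hz0
      z_le_one := hz1
      serv := fun q => lev (X q)
      sum_z := fun i => by convert hsumY i
      sum_serv := fun q i => by convert hsumX q i
      cand := fun q => lev (U q)
      cand_subset := fun q hq => hmono (hUX q hq)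
      sum_cand := fun q hq => by
        rw [← Finset.sum_fiberwise _ fac,
          Finset.sum_congr rfl fun i _ => hsumU q hq i]
        simp only [hU]
        rw [← Finset.sum_div, div_self (by linarith [hSel q hq])] }
  let R : P → P → Prop := fun q q' => S.radius d q ≤ S.radius d q'
  have : Std.Total R := ⟨fun q q' => le_total _ _⟩
  have : IsTrans P R := ⟨fun _ _ _ h h' => le_trans h h'⟩
  let l := (Finset.univ.filter Sel).toList.insertionSort R
  have hl := List.perm_insertionSort R (Finset.univ.filter Sel).toList
  exact ⟨{ S with
    order := l
    order_nodup := hl.nodup_iff.2 (Finset.nodup_toList _)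
    mem_order := fun q => by rw [hl.mem_iff]; simp
    order_sorted := List.pairwise_insertionSort R _ }⟩

variable {F D Scen : Type*} [Fintype F] [Fintype D] [Fintype Scen]

theorem Feasible.parts {I : Inst F D Scen} {s : Sol F D Scen} (hs : Feasible I s) {A : Scen}
    {j : D} (hj : j ∈ I.clients A) (i : F) :
    0 ≤ s.x₁ A i j ∧ s.x₁ A i j ≤ s.y₁ i ∧ 0 ≤ s.x₂ A i j ∧ s.x₂ A i j ≤ s.y₂ A i ∧
      s.x₁ A i j + s.x₂ A i j = s.x A i j := by
  have h1 := hs.1 i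
  have h2 := (hs.2 A).2.1 i
  obtain ⟨hx0, hx⟩ := ((hs.2 A).2.2 j hj).2 i
  have hy := add_nonneg h1 h2
  have key : ∀ y, 0 ≤ y → s.x A i j * (y / (s.y₁ i + s.y₂ A i)) ≤ y := fun y hy0 => by
    rw [mul_div_assoc', mul_comm, mul_div_assoc]
    exact mul_le_of_le_one_right hy0 (div_le_one_of_le₀ hx hy)
  refine ⟨mul_nonneg hx0 (div_nonneg h1 hy), key _ h1, mul_nonneg hx0 (div_nonneg h2 hy),
    key _ h2, ?_⟩
  rw [Sol.x₁, Sol.x₂, ← mul_add, ← add_div]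
  -- If both openings vanish, the quotients are `0 / 0 = 0`, and the constraint forces `x = 0` as
  -- well.
  rcases hy.eq_or_lt with h | h
  · rw [← h] at hx
    rw [le_antisymm hx hx0, zero_mul]
  · rw [div_self h.ne', mul_one]

/-- Total service is at least 1, so a pair served below `1/2` in Stage I gets more than `1/2` in
Stage II. After doubling, the stage that clusters a pair serves it to extent at least one. -/
theorem exists_run (I : Inst F D Scen) (s : Sol F D Scen) (hs : Feasible I s) :
    Nonempty (Run I s) := by
  classical
  have h₁ := exists_stageRun (P := {q : Scen × D // q.2 ∈ I.clients q.1})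
    (fun i => 2 * s.y₁ i) (fun q i => 2 * s.x₁ q.1.1 i q.1.2)
    (fun q => FirstStage s q.1.1 q.1.2) (fun q i => I.c i q.1.2)
    (fun i => by linarith [hs.1 i]) (fun q i => by linarith [(hs.parts q.2 i).1])
    (fun q i => by linarith [(hs.parts q.2 i).2.1])
    (fun q hq => by
      rw [FirstStage] at hq
      rw [← Finset.mul_sum]
      linarith)
  have h₂ : ∀ A, Nonempty (StageRun (P := {j : D // j ∈ I.clients A})
      (fun i => 2 * s.y₂ A i) (fun j i => 2 * s.x₂ A i j.1)
      (fun j => ¬ FirstStage s A j.1) (fun j i => I.c i j.1)) := fun A =>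
    exists_stageRun _ _ _ _
      (fun i => by linarith [(hs.2 A).2.1 i]) (fun q i => by linarith [(hs.parts q.2 i).2.2.1])
      (fun q i => by linarith [(hs.parts q.2 i).2.2.2.1])
      (fun q hq => by
        rw [FirstStage, not_le] at hq
        have h := ((hs.2 A).2.2 q.1 q.2).1
        rw [← Finset.sum_congr rfl fun i _ => (hs.parts q.2 i).2.2.2.2,
          Finset.sum_add_distrib] at h
        rw [← Finset.mul_sum]
        linarith)
  exact ⟨⟨h₁.some, fun A => (h₂ A).some⟩⟩

end Existence

/-! ### Guarantees of a single stage -/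

section Stage

/-- Each candidate meets a cluster that was formed from a candidate considered no later. -/
theorem exists_greedyCluster {P G : Type*} (cand : P → Finset G) (r : P → P → Prop)
    (hr : ∀ q, r q q) (order : List P) : order.Pairwise r → (∀ q ∈ order, (cand q).Nonempty) →
    ∀ q ∈ order, ∃ q' ∈ order, r q' q ∧ cand q' ∈ greedyClusters cand order ∧
      ¬ Disjoint (cand q') (cand q) := by
  classical
  induction order using List.reverseRecOn with
  | nil => simp
  | append_singleton l p ih =>
    intro hp hne q hq
    have e : greedyClusters cand (l ++ [p]) =
        if ∀ K ∈ greedyClusters cand l, Disjoint K (cand p) then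
          insert (cand p) (greedyClusters cand l) else greedyClusters cand l := by
      simp only [greedyClusters, List.foldl_append, List.foldl_cons, List.foldl_nil]
      congr
    have hsub : greedyClusters cand l ⊆ greedyClusters cand (l ++ [p]) := by
      rw [e]
      split_ifs
      exacts [Finset.subset_insert _ _, subset_rfl]
    obtain ⟨hl, -, hlp⟩ := List.pairwise_append.1 hp
    rcases List.mem_append.1 hq with hq | hq
    · obtain ⟨q', hq', h1, h2, h3⟩ := ih hl (fun q hq => hne q (by simp [hq])) q hq
      exact ⟨q', by simp [hq'], h1, hsub h2, h3⟩
    · obtain rfl := List.mem_singleton.1 hq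
      by_cases h : ∀ K ∈ greedyClusters cand l, Disjoint K (cand q)
      · refine ⟨q, by simp, hr q, ?_, ?_⟩
        · rw [e, if_pos h]
          exact Finset.mem_insert_self _ _
        · rw [disjoint_self]
          exact (hne q (by simp)).ne_empty
      · push Not at h
        obtain ⟨K, hK, hd⟩ := h
        obtain ⟨q', hq', rfl⟩ := (greedyClusters_spec cand l).1 K hK
        exact ⟨q', by simp [hq'], hlp q' hq' q (by simp), hsub hK, hd⟩

variable {F P : Type*} {Y : F → ℝ} {X : P → F → ℝ} {Sel : P → Prop} {d : P → F → ℝ}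

theorem Splitting.le_radius (S : Splitting Y X Sel) (d : P → F → ℝ) {q : P} {g : Fin S.n}
    (hg : g ∈ S.cand q) : d q (S.fac g) ≤ S.radius d q := by
  rw [Splitting.radius, dif_pos ⟨g, hg⟩]
  exact Finset.le_sup' (fun g => d q (S.fac g)) hg

theorem Splitting.cand_nonempty (S : Splitting Y X Sel) {q : P} (hq : Sel q) :
    (S.cand q).Nonempty := by
  by_contra h
  have := S.sum_cand q hq
  rw [Finset.not_nonempty_iff_eq_empty.1 h, Finset.sum_empty] at this
  exact zero_ne_one this

theorem Splitting.serv_ne_zero (S : Splitting Y X Sel) {q : P} {g : Fin S.n}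
    (hg : g ∈ S.serv q) : X q (S.fac g) ≠ 0 := by
  classical
  rw [← S.sum_serv q]
  refine (Finset.sum_pos (fun g _ => S.z_pos g) ⟨g, ?_⟩).ne'
  simp [hg]

/-- Candidates consist of serving copies, and these belong to facilities with `X q i ≠ 0`. This is
where the dual bound on the serving distances enters the radius. -/
theorem Splitting.radius_le (S : Splitting Y X Sel) {q : P} (hq : Sel q) {V : ℝ}
    (h : ∀ i, X q i ≠ 0 → d q i ≤ V) : S.radius d q ≤ V := by
  rw [Splitting.radius, dif_pos (S.cand_nonempty hq)]
  exact Finset.sup'_le _ _ fun g hg => h _ (S.serv_ne_zero (S.cand_subset q hq hg))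

theorem Splitting.sum_serv_mul [Fintype F] (S : Splitting Y X Sel) (q : P) (a : F → ℝ) :
    ∑ g ∈ S.serv q, S.z g * a (S.fac g) = ∑ i, X q i * a i := by
  classical
  rw [← Finset.sum_fiberwise _ S.fac]
  refine Finset.sum_congr rfl fun i _ => ?_
  rw [← S.sum_serv q i, Finset.sum_mul]
  refine Finset.sum_congr (by congr) fun g hg => ?_
  rw [(Finset.mem_filter.1 hg).2]

theorem StageRun.clusters_disjoint (S : StageRun Y X Sel d) :
    ∀ K ∈ S.clusters, ∀ K' ∈ S.clusters, K ≠ K' → Disjoint K K' :=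
  (greedyClusters_spec S.cand S.order).2

theorem StageRun.sum_cluster (S : StageRun Y X Sel d) : ∀ K ∈ S.clusters, ∑ g ∈ K, S.z g = 1 := by
  intro K hK
  obtain ⟨q, hq, rfl⟩ := (greedyClusters_spec S.cand S.order).1 K hK
  exact S.sum_cand q ((S.mem_order q).1 hq)

theorem StageRun.prob_nonneg (S : StageRun Y X Sel d) (O : Finset (Fin S.n)) : 0 ≤ S.prob O :=
  openProb_nonneg (fun g => (S.z_pos g).le) S.z_le_one _ _

open Classical in
/-- With probability one, some open facility is within three times the radius. -/
theorem StageRun.exists_open_near (S : StageRun Y X Sel d)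
    (htri : ∀ q q' i i', d q i ≤ d q i' + d q' i' + d q' i) {O : Finset (Fin S.n)}
    (hO : S.prob O ≠ 0) {q : P} (hq : Sel q) :
    ∃ i ∈ S.facs O, d q i ≤ 3 * S.radius d q := by
  obtain ⟨q', -, hrad, hcl, hdis⟩ := exists_greedyCluster S.cand
    (fun q q' => S.radius d q ≤ S.radius d q') (fun _ => le_rfl) S.order S.order_sorted
    (fun q hq => S.cand_nonempty ((S.mem_order q).1 hq)) q ((S.mem_order q).2 hq)
  obtain ⟨h, hhO, hh⟩ := exists_mem_of_openProb_ne_zero hO hcl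
  obtain ⟨g, hg', hg⟩ := Finset.not_disjoint_iff.1 hdis
  refine ⟨S.fac h, Finset.mem_image_of_mem _ hhO, ?_⟩
  -- The path runs from `q` to the shared copy `g`, to the owner `q'` of the cluster, to its open
  -- copy `h`. The last two edges are at most the radius of `q'`, which is no larger than that of
  -- `q`.
  linarith [htri q q' (S.fac h) (S.fac g), S.le_radius d hg, S.le_radius d hg', S.le_radius d hh]

open Classical in
theorem StageRun.sum_prob_miss_le (S : StageRun Y X Sel d) (T : Finset (Fin S.n)) :
    ∑ O with Disjoint O T, S.prob O ≤ Real.exp (-∑ g ∈ T, S.z g) := by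
  convert openProb_miss_le_exp (fun g => (S.z_pos g).le) S.z_le_one S.clusters_disjoint
    S.sum_cluster T
  rfl

open Classical in
/-- A facility is opened in a stage with probability at most its scaled opening value. -/
theorem StageRun.sum_prob_yhat_le (S : StageRun Y X Sel d) (i : F) :
    ∑ O, S.prob O * yhat (S.facs O) i ≤ Y i := by
  have h : ∀ O, yhat (S.facs O) i ≤ ∑ g with S.fac g = i, if g ∈ O then (1 : ℝ) else 0 := by
    intro O
    have h0 : ∀ g ∈ Finset.univ.filter fun g => S.fac g = i,
      (0 : ℝ) ≤ if g ∈ O then (1 : ℝ) else 0 := fun g _ => by split_ifs <;> simp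
    rw [yhat]
    split_ifs with hi
    · obtain ⟨g, hg, rfl⟩ := Finset.mem_image.1 hi
      refine le_trans ?_ (Finset.single_le_sum h0 (a := g) (by simp))
      simp [hg]
    · exact Finset.sum_nonneg h0
  calc ∑ O, S.prob O * yhat (S.facs O) i
      ≤ ∑ O, S.prob O * ∑ g with S.fac g = i, if g ∈ O then (1 : ℝ) else 0 :=
        Finset.sum_le_sum fun O _ => mul_le_mul_of_nonneg_left (h O) (S.prob_nonneg O)
    _ = ∑ g with S.fac g = i, ∑ O with g ∈ O, S.prob O := by
        simp only [Finset.mul_sum, mul_ite, mul_one, mul_zero]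
        rw [Finset.sum_comm]
        exact Finset.sum_congr rfl fun g _ => (Finset.sum_filter _ _).symm
    _ = ∑ g with S.fac g = i, S.z g := Finset.sum_congr rfl fun g _ => by
        convert openProb_hit_singleton S.clusters_disjoint S.sum_cluster g
        rfl
    _ = Y i := by
        rw [← S.sum_z i]

end Stage

/-! ### Combining the two independent stages -/

section TwoStages

variable {F P₁ P₂ : Type*} {Y₁ Y₂ : F → ℝ} {X₁ : P₁ → F → ℝ} {X₂ : P₂ → F → ℝ}
  {Sel₁ : P₁ → Prop} {Sel₂ : P₂ → Prop} {d₁ : P₁ → F → ℝ} {d₂ : P₂ → F → ℝ}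

open Classical in
/-- A set of copies serving a client that is served to a total extent of two is hit with a
probability of at least `(1 - e⁻²) / 2` times its total opening. -/
theorem hit_prob_ge (S₁ : StageRun Y₁ X₁ Sel₁ d₁) (S₂ : StageRun Y₂ X₂ Sel₂ d₂)
    (T : Finset (Fin S₁.n ⊕ Fin S₂.n)) (hT : ∑ g ∈ T, Sum.elim S₁.z S₂.z g ≤ 2) :
    (1 - Real.exp (-2)) / 2 * ∑ g ∈ T, Sum.elim S₁.z S₂.z g ≤
      ∑ ω : Finset (Fin S₁.n) × Finset (Fin S₂.n) with ¬ Disjoint (ω.1.disjSum ω.2) T,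
        S₁.prob ω.1 * S₂.prob ω.2 := by
  have htot : ∑ ω : Finset (Fin S₁.n) × Finset (Fin S₂.n), S₁.prob ω.1 * S₂.prob ω.2 = 1 := by
    rw [Fintype.sum_prod_type, ← Finset.sum_mul_sum, S₁.prob_sum, S₂.prob_sum, one_mul]
  have hdis : ∀ ω : Finset (Fin S₁.n) × Finset (Fin S₂.n), Disjoint (ω.1.disjSum ω.2) T ↔
      Disjoint ω.1 T.toLeft ∧ Disjoint ω.2 T.toRight := fun ω => by
    simp [Finset.disjoint_left]
  have hmiss : ∑ ω : Finset (Fin S₁.n) × Finset (Fin S₂.n) with Disjoint (ω.1.disjSum ω.2) T,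
      S₁.prob ω.1 * S₂.prob ω.2 ≤ Real.exp (-∑ g ∈ T, Sum.elim S₁.z S₂.z g) := by
    have e : (Finset.univ.filter fun ω : Finset (Fin S₁.n) × Finset (Fin S₂.n) =>
        Disjoint (ω.1.disjSum ω.2) T) = (Finset.univ.filter fun O => Disjoint O T.toLeft) ×ˢ
          (Finset.univ.filter fun O => Disjoint O T.toRight) := by
      ext ω
      simp [hdis]
    have e' : ∑ g ∈ T, Sum.elim S₁.z S₂.z g = ∑ g ∈ T.toLeft, S₁.z g + ∑ g ∈ T.toRight, S₂.z g := by
      conv_lhs => rw [← Finset.toLeft_disjSum_toRight (u := T)]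
      rw [Finset.sum_disjSum]
      rfl
    rw [e, Finset.sum_product, ← Finset.sum_mul_sum, e', neg_add, Real.exp_add]
    exact mul_le_mul (S₁.sum_prob_miss_le _) (S₂.sum_prob_miss_le _)
      (Finset.sum_nonneg fun O _ => S₂.prob_nonneg O) (Real.exp_pos _).le
  have h0 : 0 ≤ ∑ g ∈ T, Sum.elim S₁.z S₂.z g := Finset.sum_nonneg fun g _ => by
    rcases g with g | g
    exacts [(S₁.z_pos g).le, (S₂.z_pos g).le]
  rw [← Finset.sum_filter_add_sum_filter_not _ (fun ω : Finset (Fin S₁.n) × Finset (Fin S₂.n) =>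
    Disjoint (ω.1.disjSum ω.2) T)] at htot
  linarith [chord_le_one_sub_exp h0 hT]

/-- The expected distance from a client to the closest open facility. -/
theorem expected_dist_le [Fintype F] (S₁ : StageRun Y₁ X₁ Sel₁ d₁) (S₂ : StageRun Y₂ X₂ Sel₂ d₂)
    (q₁ : P₁) (q₂ : P₂) (x c : F → ℝ) (V : ℝ) (hV : 0 ≤ V)
    (hx : ∀ i, X₁ q₁ i + X₂ q₂ i = 2 * x i) (hx1 : ∑ i, x i = 1)
    (h₁ : ∀ i, X₁ q₁ i ≠ 0 → c i ≤ V) (h₂ : ∀ i, X₂ q₂ i ≠ 0 → c i ≤ V)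
    (dist : Finset (Fin S₁.n) × Finset (Fin S₂.n) → ℝ)
    (hfar : ∀ ω, S₁.prob ω.1 * S₂.prob ω.2 ≠ 0 → dist ω ≤ 3 * V)
    (hd₁ : ∀ ω, ∀ i ∈ S₁.facs ω.1, dist ω ≤ c i) (hd₂ : ∀ ω, ∀ i ∈ S₂.facs ω.2, dist ω ≤ c i) :
    ∑ ω, S₁.prob ω.1 * S₂.prob ω.2 * dist ω ≤
      3 * Real.exp (-2) * V + (1 - Real.exp (-2)) * ∑ i, c i * x i := by
  classical
  have hμ : ∀ ω : Finset (Fin S₁.n) × Finset (Fin S₂.n), 0 ≤ S₁.prob ω.1 * S₂.prob ω.2 :=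
    fun ω => mul_nonneg (S₁.prob_nonneg _) (S₂.prob_nonneg _)
  have htot : ∑ ω : Finset (Fin S₁.n) × Finset (Fin S₂.n), S₁.prob ω.1 * S₂.prob ω.2 = 1 := by
    rw [Fintype.sum_prod_type, ← Finset.sum_mul_sum, S₁.prob_sum, S₂.prob_sum, one_mul]
  have hz : ∀ g, 0 ≤ Sum.elim S₁.z S₂.z g := fun g => by
    rcases g with g | g
    exacts [(S₁.z_pos g).le, (S₂.z_pos g).le]
  have hserv : ∀ a : F → ℝ, ∑ g ∈ (S₁.serv q₁).disjSum (S₂.serv q₂),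
      Sum.elim S₁.z S₂.z g * a (Sum.elim S₁.fac S₂.fac g) = 2 * ∑ i, x i * a i := fun a => by
    rw [Finset.sum_disjSum]
    simp only [Sum.elim_inl, Sum.elim_inr]
    rw [S₁.sum_serv_mul q₁ a, S₂.sum_serv_mul q₂ a, ← Finset.sum_add_distrib, Finset.mul_sum]
    refine Finset.sum_congr rfl fun i _ => ?_
    rw [← add_mul, hx, mul_assoc]
  have hserv1 : ∑ g ∈ (S₁.serv q₁).disjSum (S₂.serv q₂), Sum.elim S₁.z S₂.z g = 2 := by
    have := hserv fun _ => 1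
    simpa only [mul_one, hx1] using this
  have hcV : ∀ g ∈ (S₁.serv q₁).disjSum (S₂.serv q₂), c (Sum.elim S₁.fac S₂.fac g) ≤ V := by
    intro g hg
    rcases g with g | g
    · exact h₁ _ (S₁.serv_ne_zero (Finset.inl_mem_disjSum.1 hg))
    · exact h₂ _ (S₂.serv_ne_zero (Finset.inr_mem_disjSum.1 hg))
  -- Values are savings against the fallback distance `3 * V`, nonnegative because serving
  -- facilities lie within `V`. The total opening 2 cancels the denominator of `(1 - exp (-2)) / 2`.
  have key := sum_le_of_hit hμ (fun ω => ω.1.disjSum ω.2) (Sum.elim S₁.z S₂.z)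
    ((1 - Real.exp (-2)) / 2) ((S₁.serv q₁).disjSum (S₂.serv q₂))
    (fun T hT => by
      convert hit_prob_ge S₁ S₂ T
        ((Finset.sum_le_sum_of_subset_of_nonneg hT fun g _ _ => hz g).trans hserv1.le))
    (fun g => 3 * V - c (Sum.elim S₁.fac S₂.fac g)) (fun ω => 3 * V - dist ω)
    (fun g hg => by linarith [hcV g hg]) (fun ω hω => by linarith [hfar ω hω])
    (fun ω _ g _ hgO => by
      refine sub_le_sub_left ?_ _
      rcases g with g | g
      · exact hd₁ ω _ (Finset.mem_image_of_mem _ (Finset.inl_mem_disjSum.1 hgO))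
      · exact hd₂ ω _ (Finset.mem_image_of_mem _ (Finset.inr_mem_disjSum.1 hgO)))
  rw [hserv fun i => 3 * V - c i] at key
  simp only [mul_sub, Finset.sum_sub_distrib, ← Finset.sum_mul, htot, hx1] at key
  have e : ∑ i, x i * c i = ∑ i, c i * x i := Finset.sum_congr rfl fun i _ => mul_comm _ _
  rw [e] at key
  linarith

end TwoStages

/-! ### Feasibility and expected cost of the algorithm -/

section Analysis

variable {F D Scen : Type*} [Fintype F] [Fintype D] [Fintype Scen]

/-- The distance from a client to the facility that it is connected to. -/
def xhatDist (I : Inst F D Scen) (O : Finset F) (j : D) : ℝ := ∑ i, I.c i j * xhat I O i j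

theorem sum_xhat (I : Inst F D Scen) {O : Finset F} (h : O.Nonempty) (j : D) :
    ∑ i, xhat I O i j = 1 := by
  classical
  simp only [xhat, dif_pos h, Finset.sum_ite_eq', Finset.mem_univ, if_true]

theorem nearest_mem (I : Inst F D Scen) {O : Finset F} (h : O.Nonempty) (j : D) :
    nearest I O h j ∈ O :=
  (O.exists_min_image (fun i => I.c i j) h).choose_spec.1

theorem xhatDist_le (I : Inst F D Scen) {O : Finset F} {i : F} (hi : i ∈ O) (j : D) :
    xhatDist I O j ≤ I.c i j := by
  have h : O.Nonempty := ⟨i, hi⟩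
  have e : xhatDist I O j = I.c (nearest I O h j) j := by
    classical
    simp only [xhatDist, xhat, dif_pos h, mul_ite, mul_one, mul_zero, Finset.sum_ite_eq',
      Finset.mem_univ, if_true]
  rw [e]
  exact (O.exists_min_image (fun i => I.c i j) h).choose_spec.2 i hi

theorem yhat_nonneg {F : Type*} (O : Finset F) (i : F) : 0 ≤ yhat O i := by
  rw [yhat]
  split_ifs <;> simp

variable {I : Inst F D Scen} {s : Sol F D Scen}

theorem Run.mem_opened (r : Run I s) {A : Scen} {O₁ : Finset (Fin r.first.n)}
    {O₂ : Finset (Fin (r.second A).n)} {i : F} :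
    i ∈ r.opened A O₁ O₂ ↔ i ∈ r.first.facs O₁ ∨ i ∈ (r.second A).facs O₂ := by
  classical
  exact Finset.mem_union

/-- If all facilities serving a client are within distance `V`, then with probability one some open
facility is within distance `3 * V`. -/
theorem Run.exists_opened_near (r : Run I s) {A : Scen}
    {O₁ : Finset (Fin r.first.n)} {O₂ : Finset (Fin (r.second A).n)} (h₁ : r.first.prob O₁ ≠ 0)
    (h₂ : (r.second A).prob O₂ ≠ 0) {j : D} (hj : j ∈ I.clients A) {V : ℝ}
    (hV : ∀ i, s.x A i j ≠ 0 → I.c i j ≤ V) : ∃ i ∈ r.opened A O₁ O₂, I.c i j ≤ 3 * V := by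
  by_cases hf : FirstStage s A j
  · obtain ⟨i, hi, hd⟩ := r.first.exists_open_near (fun q q' i i' => I.c_triangle i i' q.1.2 q'.1.2)
      h₁ (q := ⟨(A, j), hj⟩) hf
    refine ⟨i, r.mem_opened.2 (Or.inl hi), hd.trans ?_⟩
    have := r.first.radius_le (d := fun q i => I.c i q.1.2) (q := ⟨(A, j), hj⟩) hf (V := V)
      fun i hi => hV i fun h => hi (by simp [Sol.x₁, h])
    linarith
  · obtain ⟨i, hi, hd⟩ := (r.second A).exists_open_near (fun q q' i i' => I.c_triangle i i' q.1 q'.1)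
      h₂ (q := ⟨j, hj⟩) hf
    refine ⟨i, r.mem_opened.2 (Or.inr hi), hd.trans ?_⟩
    have := (r.second A).radius_le (d := fun q i => I.c i q.1) (q := ⟨j, hj⟩) hf (V := V)
      fun i hi => hV i fun h => hi (by simp [Sol.x₂, h])
    linarith

theorem Run.outcomeFeasible (r : Run I s) (A : Scen)
    (O₁ : Finset (Fin r.first.n)) (O₂ : Finset (Fin (r.second A).n))
    (h₁ : r.first.prob O₁ ≠ 0) (h₂ : (r.second A).prob O₂ ≠ 0) : r.OutcomeFeasible A O₁ O₂ := by
  refine ⟨yhat_nonneg _, yhat_nonneg _, fun j hj => ?_⟩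
  -- Only the existence of an open facility matters here, so any bound on all distances will do.
  obtain ⟨i₀, hi₀, -⟩ := r.exists_opened_near h₁ h₂ hj (V := ∑ i, I.c i j)
    fun i _ => Finset.single_le_sum (f := fun i => I.c i j) (fun i _ => I.c_nonneg i j)
      (Finset.mem_univ i)
  have hne : (r.opened A O₁ O₂).Nonempty := ⟨i₀, hi₀⟩
  refine ⟨(sum_xhat I hne j).ge, fun i => ?_⟩
  rw [xhat, dif_pos hne]
  split_ifs with h
  · refine ⟨zero_le_one, ?_⟩
    have h1 := yhat_nonneg (r.first.facs O₁) i
    have h2 := yhat_nonneg ((r.second A).facs O₂) i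
    have hi := nearest_mem I hne j
    rw [← h, r.mem_opened] at hi
    rcases hi with hi | hi
    · have : yhat (r.first.facs O₁) i = 1 := by simp [yhat, hi]
      linarith
    · have : yhat ((r.second A).facs O₂) i = 1 := by simp [yhat, hi]
      linarith
  · exact ⟨le_rfl, add_nonneg (yhat_nonneg _ _) (yhat_nonneg _ _)⟩

/-- The expected connection cost of a client. -/
theorem Run.expected_xhatDist_le (hs : Feasible I s) (r : Run I s) {A : Scen} {j : D}
    (hj : j ∈ I.clients A) {V : ℝ} (hV0 : 0 ≤ V) (hV : ∀ i, s.x A i j ≠ 0 → I.c i j ≤ V)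
    (hV1 : V ≠ 0 → ∑ i, s.x A i j = 1) :
    ∑ ω : Finset (Fin r.first.n) × Finset (Fin (r.second A).n),
        r.first.prob ω.1 * (r.second A).prob ω.2 * xhatDist I (r.opened A ω.1 ω.2) j ≤
      3 * Real.exp (-2) * V + (1 - Real.exp (-2)) * ∑ i, I.c i j * s.x A i j := by
  have hfar : ∀ ω : Finset (Fin r.first.n) × Finset (Fin (r.second A).n),
      r.first.prob ω.1 * (r.second A).prob ω.2 ≠ 0 →
      xhatDist I (r.opened A ω.1 ω.2) j ≤ 3 * V := fun ω hω => by
    obtain ⟨i, hi, hd⟩ := r.exists_opened_near (left_ne_zero_of_mul hω)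
      (right_ne_zero_of_mul hω) hj hV
    exact (xhatDist_le I hi j).trans hd
  -- When `V = 0` the client may be served to an extent above 1, so the hitting argument is
  -- unavailable. But then the fallback distance `3 * V` is already 0.
  by_cases h : V = 0
  · have h1 : ∑ ω : Finset (Fin r.first.n) × Finset (Fin (r.second A).n),
        r.first.prob ω.1 * (r.second A).prob ω.2 * xhatDist I (r.opened A ω.1 ω.2) j ≤ 0 := by
      refine Finset.sum_nonpos fun ω _ => ?_
      by_cases hω : r.first.prob ω.1 * (r.second A).prob ω.2 = 0
      · rw [hω, zero_mul]
      · refine mul_nonpos_of_nonneg_of_nonpos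
          (mul_nonneg (r.first.prob_nonneg _) ((r.second A).prob_nonneg _)) ?_
        simpa [h] using hfar ω hω
    have h2 : 0 ≤ (1 - Real.exp (-2)) * ∑ i, I.c i j * s.x A i j := by
      refine mul_nonneg ?_ (Finset.sum_nonneg fun i _ => mul_nonneg (I.c_nonneg i j)
        (((hs.2 A).2.2 j hj).2 i).1)
      have := Real.exp_le_one_iff.2 (show (-2 : ℝ) ≤ 0 by norm_num)
      linarith
    rw [h, mul_zero, zero_add]
    exact h1.trans h2
  · exact expected_dist_le r.first (r.second A) ⟨(A, j), hj⟩ ⟨j, hj⟩ (fun i => s.x A i j)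
      (fun i => I.c i j) V hV0
      (fun i => by
        have := (hs.parts hj i).2.2.2.2
        simp only
        linarith)
      (hV1 h) (fun i hi => hV i fun h => hi (by simp [Sol.x₁, h]))
      (fun i hi => hV i fun h => hi (by simp [Sol.x₂, h]))
      (fun ω => xhatDist I (r.opened A ω.1 ω.2) j) hfar
      (fun ω i hi => xhatDist_le I (r.mem_opened.2 (Or.inl hi)) j)
      (fun ω i hi => xhatDist_le I (r.mem_opened.2 (Or.inr hi)) j)

/-- The expected cost of a scenario splits into opening and connection costs. -/
theorem Run.expScenCost_eq (r : Run I s) (A : Scen) :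
    r.expScenCost A = ∑ i, (I.f₁ i * ∑ O, r.first.prob O * yhat (r.first.facs O) i +
        I.f₂ A i * ∑ O, (r.second A).prob O * yhat ((r.second A).facs O) i) +
      ∑ j ∈ I.clients A, ∑ ω : Finset (Fin r.first.n) × Finset (Fin (r.second A).n),
        r.first.prob ω.1 * (r.second A).prob ω.2 * xhatDist I (r.opened A ω.1 ω.2) j := by
  have e1 : ∀ i, ∑ O, r.first.prob O * yhat (r.first.facs O) i =
      ∑ ω : Finset (Fin r.first.n) × Finset (Fin (r.second A).n),
        r.first.prob ω.1 * (r.second A).prob ω.2 * yhat (r.first.facs ω.1) i := fun i => by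
    rw [Fintype.sum_prod_type, ← mul_one (∑ O, _), ← (r.second A).prob_sum, Finset.sum_mul_sum]
    exact Finset.sum_congr rfl fun _ _ => Finset.sum_congr rfl fun _ _ => by ring
  have e2 : ∀ i, ∑ O, (r.second A).prob O * yhat ((r.second A).facs O) i =
      ∑ ω : Finset (Fin r.first.n) × Finset (Fin (r.second A).n),
        r.first.prob ω.1 * (r.second A).prob ω.2 * yhat ((r.second A).facs ω.2) i := fun i => by
    rw [Fintype.sum_prod_type, ← one_mul (∑ O, _), ← r.first.prob_sum, Finset.sum_mul_sum]
    exact Finset.sum_congr rfl fun _ _ => Finset.sum_congr rfl fun _ _ => by ring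
  have e3 : r.expScenCost A = ∑ ω : Finset (Fin r.first.n) × Finset (Fin (r.second A).n),
      r.first.prob ω.1 * (r.second A).prob ω.2 * r.cost A ω.1 ω.2 := by
    rw [Fintype.sum_prod_type, Run.expScenCost]
  rw [e3, Finset.sum_comm]
  simp only [e1, e2, Finset.mul_sum]
  simp only [← Finset.sum_add_distrib]
  rw [Finset.sum_comm, ← Finset.sum_add_distrib]
  refine Finset.sum_congr rfl fun ω _ => ?_
  simp only [Run.cost, scenCost, xhatDist, mul_add, Finset.mul_sum]
  congr 1
  exact Finset.sum_congr rfl fun i _ => by ring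

theorem Run.expScenCost_le (hs : Optimal I s) (r : Run I s) {v : Scen → D → ℝ}
    {w : Scen → F → D → ℝ} (h : DualOptimal I v w) {A : Scen} (hA : 0 < I.p A) :
    r.expScenCost A ≤ 3 * Real.exp (-2) * ∑ j ∈ I.clients A, v A j
      + (1 - Real.exp (-2)) * ∑ j ∈ I.clients A, ∑ i, I.c i j * s.x A i j
      + 2 * ∑ i, (I.f₁ i * s.y₁ i + I.f₂ A i * s.y₂ A i) := by
  rw [r.expScenCost_eq, add_comm]
  refine add_le_add ?_ ?_
  · rw [Finset.mul_sum, Finset.mul_sum, ← Finset.sum_add_distrib]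
    refine Finset.sum_le_sum fun j hj => ?_
    obtain ⟨h1, h2⟩ := complementary_slackness I hs h hA hj
    exact r.expected_xhatDist_le hs.1 hj (h.1.2.2.2 A j hj).1 h2 h1
  · rw [Finset.mul_sum]
    refine Finset.sum_le_sum fun i _ => ?_
    have h1 := mul_le_mul_of_nonneg_left (r.first.sum_prob_yhat_le i) (I.f₁_nonneg i)
    have h2 := mul_le_mul_of_nonneg_left ((r.second A).sum_prob_yhat_le i) (I.f₂_nonneg A i)
    linarith

/-- The threshold is the largest that the final constants allow: `1 + 2 * 0.13535 = 1.2707` exactly,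
while `2 + 3 * 0.13535 = 2.40605`. -/
theorem exp_neg_two_lt : Real.exp (-2) < 0.13535 := by
  have h := Real.exp_one_gt_d9
  have e : Real.exp (-2) = (Real.exp 1 ^ 2)⁻¹ := by
    rw [Real.exp_neg, ← Real.exp_nat_mul]
    norm_num
  rw [e, inv_lt_comm₀ (by positivity) (by norm_num)]
  calc (0.13535 : ℝ)⁻¹ < 2.7182818283 ^ 2 := by norm_num
    _ ≤ Real.exp 1 ^ 2 := by gcongr

theorem Run.expCost_le (hs : Optimal I s) (r : Run I s) :
    r.expCost ≤ 2.4061 * facCost I s + 1.2707 * connCost I s := by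
  obtain ⟨v, w, h, hval⟩ := exists_dualOptimal I s hs
  have hF : ∑ A, I.p A * ∑ i, (I.f₁ i * s.y₁ i + I.f₂ A i * s.y₂ A i) = facCost I s := by
    simp only [Finset.sum_add_distrib, mul_add, ← Finset.sum_mul, I.p_sum, one_mul, facCost]
  have h1 : r.expCost ≤ 3 * Real.exp (-2) * dualValue I v
      + (1 - Real.exp (-2)) * connCost I s + 2 * facCost I s := by
    rw [← hF, dualValue, connCost, Finset.mul_sum, Finset.mul_sum, Finset.mul_sum,
      ← Finset.sum_add_distrib, ← Finset.sum_add_distrib]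
    refine Finset.sum_le_sum fun A _ => ?_
    -- Complementary slackness says nothing about scenarios of probability zero, but these
    -- contribute nothing to either side.
    rcases (I.p_nonneg A).eq_or_lt with hA | hA
    · simp [← hA]
    · have := mul_le_mul_of_nonneg_left (r.expScenCost_le hs h hA) hA.le
      linarith
  have hF0 : 0 ≤ facCost I s :=
    add_nonneg (Finset.sum_nonneg fun i _ => mul_nonneg (I.f₁_nonneg i) (hs.1.1 i)) <|
      Finset.sum_nonneg fun A _ => mul_nonneg (I.p_nonneg A) <| Finset.sum_nonneg fun i _ =>
        mul_nonneg (I.f₂_nonneg A i) ((hs.1.2 A).2.1 i)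
  have hC0 : 0 ≤ connCost I s :=
    Finset.sum_nonneg fun A _ => mul_nonneg (I.p_nonneg A) <| Finset.sum_nonneg fun j hj =>
      Finset.sum_nonneg fun i _ => mul_nonneg (I.c_nonneg i j) (((hs.1.2 A).2.2 j hj).2 i).1
  have he := exp_neg_two_lt
  rw [hval] at h1
  nlinarith [mul_le_mul_of_nonneg_right he.le hF0, mul_le_mul_of_nonneg_right he.le hC0]

end Analysis

end TwoStageFL

end

theorem mainTheorem4 {F D Scen : Type*} [Fintype F] [Fintype D] [Fintype Scen]
    (I : TwoStageFL.Inst F D Scen) (s : TwoStageFL.Sol F D Scen)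
    (hs : TwoStageFL.Optimal I s) :
    -- the algorithm can be run
    Nonempty (TwoStageFL.Run I s) ∧
    ∀ r : TwoStageFL.Run I s,
      -- it always delivers a feasible integral solution
      (∀ (A : Scen) (O₁ : Finset (Fin r.first.n)) (O₂ : Finset (Fin (r.second A).n)),
        r.first.prob O₁ ≠ 0 → (r.second A).prob O₂ ≠ 0 → r.OutcomeFeasible A O₁ O₂) ∧
      -- the expected cost in each scenario
      (∀ (v : Scen → D → ℝ) (w : Scen → F → D → ℝ), TwoStageFL.DualOptimal I v w →
        ∀ A : Scen, 0 < I.p A →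
          r.expScenCost A ≤
            3 * Real.exp (-2) * ∑ j ∈ I.clients A, v A j
            + (1 - Real.exp (-2)) * ∑ j ∈ I.clients A, ∑ i, I.c i j * s.x A i j
            + 2 * ∑ i, (I.f₁ i * s.y₁ i + I.f₂ A i * s.y₂ A i)) ∧
      -- the expected total cost
      r.expCost ≤ 2.4061 * TwoStageFL.facCost I s + 1.2707 * TwoStageFL.connCost I s := by
  refine ⟨TwoStageFL.exists_run I s hs.1, fun r => ⟨fun A O₁ O₂ => r.outcomeFeasible A O₁ O₂,
    fun v w h A hA => r.expScenCost_le hs h hA, r.expCost_le hs⟩⟩
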